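/- Let $n\ge 2$ and let $(M,\langle\cdot,\cdot\rangle,I,\Psi)$ be a special almost Hermitian $2n$-manifold: a smooth Riemannian $2n$-manifold with a smooth orthogonal almost complex structure $I$ and a smooth complex volume form $\Psi=\psi_++i\psi_-$ of type $(n,0)$ (that is, $\Psi(IX_1,X_2,\dots,X_n)=i\,\Psi(X_1,\dots,X_n)$) and of unit length ($|\Psi(u_1,\dots,u_n)|=1$ for every unitary basis of a tangent space). Let $\nabla$ be the Levi-Civita connection, let $\xi_XY=-\tfrac12 I(\nabla_XI)Y$ and $\widetilde\nabla=\nabla+\xi$, and let $\overline\nabla$ be the minimal $SU(n)$-connection, i.e. the metric connection with $\overline\nabla I=0$, $\overline\nabla\Psi=0$ for which $\overline\nabla-\nabla$ takes values in $\mathfrak{su}(n)^\perp\subset\mathfrak{so}(2n)$. Then $\overline\nabla=\nabla+\xi+\eta$ with $\eta_XY=\hat\eta(X)IY$ for a one-form $\hat\eta$. With $R_{X,Y}=\nabla_{[X,Y]}-[\nabla_X,\nabla_Y]$, an orthonormal basis $e_1,\dots,e_{2n}$ of the tangent space, and summation over repeated indices, put $\mathrm{Ric}(X,Y)=\langle R_{X,e_i}Y,e_i\rangle$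 and $\mathrm{Ric}^*(X,Y)=\langle R_{X,e_i}IY,Ie_i\rangle$; for a bilinear form $b$ let $b_H(X,Y)=\tfrac12\big(b(X,Y)+b(IX,IY)\big)$; and let $d\hat\eta(X,Y)=X\hat\eta(Y)-Y\hat\eta(X)-\hat\eta([X,Y])$. Then $3\,\mathrm{Ric}^*_H+\mathrm{Ric}_H=T$, where $$\begin{aligned} T(X,Y)={}& 2n\,d\hat\eta(X,IY)-2n\,d\hat\eta(IX,Y)-\langle(\widetilde\nabla_{e_i}\xi)_XY,e_i\rangle+\langle(\widetilde\nabla_X\xi)_{e_i}Y,e_i\rangle\\ &-\langle(\widetilde\nabla_{e_i}\xi)_{IX}IY,e_i\rangle+\langle(\widetilde\nabla_{IX}\xi)_{e_i}IY,e_i\rangle-\langle\xi_{\xi_{e_i}X}Y,e_i\rangle+\langle\xi_{\xi_Xe_i}Y,e_i\rangle\\ &-\langle\xi_{\xi_{e_i}IX}IY,e_i\rangle+\langle\xi_{\xi_{IX}e_i}IY,e_i\rangle-2\langle\xi_Xe_i,\xi_{IY}Ie_i\rangle-2\langle\xi_Ye_i,\xi_{IX}Ie_i\rangle . \end{aligned}$$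 Consequently the intrinsic torsion determines the components of the curvature tensor $R(X,Y,Z,W)=\langle R_{X,Y}Z,W\rangle$ in $\mathcal K_1$ and $\mathcal K_2$, where $\mathcal K$ is the space of algebraic curvature tensors with values in $\mathfrak u(n)$, $\mathcal C_3\subset\mathcal K$ consists of those with values in $\mathfrak{su}(n)$, $\mathcal K_1$ is the space of $U(n)$-invariant elements of $\mathcal K$ orthogonal to $\mathcal C_3$, and $\mathcal K_2$ is the orthogonal complement of $\mathcal C_3+\mathcal K_1$ in $\mathcal K$. Explicitly, write $g=\langle\cdot,\cdot\rangle$, $\omega(X,Y)=g(X,IY)$ and, for a symmetric bilinear form $b$ with $b=b_H$, write $\beta(X,Y)=b(X,IY)$ and $$\begin{aligned} \Phi(b)(X,Y,Z,W)={}&g(X,Z)b(Y,W)+b(X,Z)g(Y,W)-g(Y,Z)b(X,W)-b(Y,Z)g(X,W)\\ &+\omega(X,Z)\beta(Y,W)+\beta(X,Z)\omega(Y,W)-\omega(Y,Z)\beta(X,W)-\beta(Y,Z)\omega(X,W)\\ &+2\,\omega(X,Y)\beta(Z,W)+2\,\beta(X,Y)\omega(Z,W). \end{aligned}$$ Then the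 orthogonal projections of $R$ to $\mathcal K_1$ and to $\mathcal K_2$ are, respectively, $$\frac{\operatorname{tr}T}{32\,n(n+1)}\,\Phi(g)\qquad\text{and}\qquad\frac1{8(n+2)}\,\Phi\Big(T-\frac{\operatorname{tr}T}{2n}\,g\Big).$$ -/

import Mathlib

open scoped Manifold ContDiff Bundle
open Bundle VectorField

noncomputable section

/-! ## Special almost Hermitian manifolds and their connections

The manifold `M` has real dimension `2 * n`, is smooth, and carries a smooth Riemannian metric
(an inner product `inner ℝ` on every tangent space). A vector field `X` is smooth at `x` when
`CMDiffAt ∞ (T% X) x`. For a covariant derivative `D`, the vector `(∇_X Y)(x)` is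
`D Y x (X x)`. A tangent vector `v` at `x` has the extension `FiberBundle.extend _ v`, a vector
field that is smooth near `x` and takes the value `v` at `x`; tensors defined by differentiating
vector fields are evaluated on such extensions. -/

namespace SAH

section Manifold

variable {n : ℕ} {E : Type*} [NormedAddCommGroup E] [NormedSpace ℝ E] [FiniteDimensional ℝ E]
  {H : Type*} [TopologicalSpace H] {I : ModelWithCorners ℝ E H}
  {M : Type*} [TopologicalSpace M] [ChartedSpace H M] [IsManifold I ∞ M]
  [RiemannianBundle (fun x : M ↦ TangentSpace I x)]
  [IsContMDiffRiemannianBundle I ∞ E (fun x : M ↦ TangentSpace I x)]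

/-- The extension of a tangent vector at `x` to a vector field that is smooth near `x`. -/
def ext {x : M} (v : TangentSpace I x) (y : M) : TangentSpace I y :=
  FiberBundle.extend E v y

variable (n I M) in
/-- A special almost Hermitian structure, that is, an `SU(n)`-structure, on the Riemannian
manifold `M`: a smooth orthogonal almost complex structure `J` and a smooth complex volume form
`Ψ = ψ₊ + i ψ₋`, which is a complex `n`-form of unit length on `(T_x M, J)`. -/
structure SpecialAlmostHermitian where
  /-- the almost complex structure -/
  J : Π x : M, TangentSpace I x →L[ℝ] TangentSpace I x
  J_J : ∀ (x : M) (v : TangentSpace I x), J x (J x v) = -v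
  J_inner : ∀ (x : M) (v w : TangentSpace I x),
    inner ℝ (J x v) (J x w) = inner ℝ v w
  J_smooth : ∀ (X : Π x : M, TangentSpace I x) (x : M),
    CMDiffAt ∞ (T% X) x → CMDiffAt ∞ (T% (fun y ↦ J y (X y))) x
  /-- the complex volume form -/
  Ψ : Π x : M, TangentSpace I x [⋀^Fin n]→ₗ[ℝ] ℂ
  Ψ_smooth : ∀ (X : Fin n → Π x : M, TangentSpace I x) (x : M),
    (∀ i, CMDiffAt ∞ (T% (X i)) x) →
      ContMDiffAt I 𝓘(ℝ, ℂ) ∞ (fun y ↦ Ψ y (fun i ↦ X i y)) x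
  /-- `Ψ` is complex multilinear. -/
  Ψ_J : ∀ (x : M) (v : Fin n → TangentSpace I x) (i : Fin n),
    Ψ x (Function.update v i (J x (v i))) = Complex.I * Ψ x v
  /-- `Ψ` has unit length: it takes a value of modulus one on every basis `u` that is unitary for
  the Hermitian product `⟨v, w⟩ + i ⟨v, J w⟩`. -/
  Ψ_unit : ∀ (x : M) (u : Fin n → TangentSpace I x),
    Orthonormal ℝ u → (∀ i j, inner ℝ (u i) (J x (u j)) = 0) → ‖Ψ x u‖ = 1

variable (I M) in
/-- Covariant derivatives on the tangent bundle of `M`. -/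
abbrev Connection :=
  CovariantDerivative I E
    (TangentSpace I : M → Type _)

/-- A connection is smooth if `∇_X Y` is smooth for smooth `X` and `Y`. -/
def IsSmooth (D : Connection I M) : Prop :=
  ∀ (X Y : Π x : M, TangentSpace I x) (x : M),
    CMDiffAt ∞ (T% X) x → CMDiffAt ∞ (T% Y) x → CMDiffAt ∞ (T% (fun y ↦ D Y y (X y))) x

/-- A connection is metric if `u ⟨X, Y⟩ = ⟨∇_u X, Y⟩ + ⟨X, ∇_u Y⟩` for vector fields `X`, `Y` that
are smooth at `x` and tangent vectors `u` at `x`. -/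
def IsMetric (D : Connection I M) : Prop :=
  ∀ (X Y : Π x : M, TangentSpace I x) (x : M) (u : TangentSpace I x),
    CMDiffAt ∞ (T% X) x → CMDiffAt ∞ (T% Y) x →
      d% (fun y ↦ (inner ℝ (X y) (Y y) : ℝ)) x u =
        inner ℝ (D X x u) (Y x) + inner ℝ (X x) (D Y x u)

/-- The Levi-Civita connection: smooth, metric and torsion-free. -/
structure IsLeviCivita (D : Connection I M) : Prop where
  smooth : IsSmooth D
  metric : IsMetric D
  torsion_free : D.torsion = 0

/-- The Lie algebra `su(n)` of the stabiliser of the metric, `J` and `Ψ` at `x`: skew-symmetric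
endomorphisms that commute with `J` and have complex trace zero. -/
def IsSU (S : SpecialAlmostHermitian n I M) (x : M)
    (B : TangentSpace I x →L[ℝ] TangentSpace I x) : Prop :=
  (∀ v w, inner ℝ (B v) w = -inner ℝ v (B w)) ∧
  (∀ v, B (S.J x v) = S.J x (B v)) ∧
  LinearMap.trace ℝ (TangentSpace I x)
    ((S.J x ∘L B : _ →L[ℝ] _) : _ →ₗ[ℝ] _) = 0

/-- The orthogonal complement of `su(n)` in `so(2n)` at `x`; the inner product of two
skew-symmetric endomorphisms `A`, `B` is a multiple of the trace of `A B`. -/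
def IsSUPerp (S : SpecialAlmostHermitian n I M) (x : M)
    (A : TangentSpace I x →L[ℝ] TangentSpace I x) : Prop :=
  (∀ v w, inner ℝ (A v) w = -inner ℝ v (A w)) ∧
  ∀ B, IsSU S x B → LinearMap.trace ℝ (TangentSpace I x)
    ((A ∘L B : _ →L[ℝ] _) : _ →ₗ[ℝ] _) = 0

/-- The difference `∇̄ - D` of two connections: `diff D Dbar x u` is the endomorphism
`v ↦ ∇̄_u v - D_u v` of `T_x M`. -/
def diff (D Dbar : Connection I M) (x : M) (u : TangentSpace I x) :
    TangentSpace I x →L[ℝ] TangentSpace I x :=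
  (Dbar.difference D x).flip u

/-- `Dbar` is the minimal `SU(n)`-connection, where `D` is the Levi-Civita connection: it is a
smooth connection for which the metric, `J` and `Ψ` are parallel, and `Dbar - D` takes values in
the orthogonal complement of `su(n)` in `so(2n)`. -/
structure IsMinimalSU (S : SpecialAlmostHermitian n I M) (D Dbar : Connection I M) : Prop where
  smooth : IsSmooth Dbar
  metric : IsMetric Dbar
  parallel_J : ∀ (Y : Π x : M, TangentSpace I x) (x : M)
    (u : TangentSpace I x), CMDiffAt ∞ (T% Y) x →
      Dbar (fun y ↦ S.J y (Y y)) x u = S.J x (Dbar Y x u)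
  parallel_Ψ : ∀ (Y : Fin n → Π x : M, TangentSpace I x) (x : M)
    (u : TangentSpace I x), (∀ i, CMDiffAt ∞ (T% (Y i)) x) →
      d% (fun y ↦ S.Ψ y (fun i ↦ Y i y)) x u =
        ∑ i, S.Ψ x (Function.update (fun j ↦ Y j x) i (Dbar (Y i) x u))
  perp : ∀ (x : M) (u : TangentSpace I x), IsSUPerp S x (diff D Dbar x u)

/-- The intrinsic `U(n)`-torsion `ξ_u v = -1/2 J (∇_u J) v`. -/
def xi (S : SpecialAlmostHermitian n I M) (D : Connection I M) (x : M)
    (u v : TangentSpace I x) : TangentSpace I x :=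
  -(1 / 2 : ℝ) • S.J x (D (fun y ↦ S.J y (ext v y)) x u - S.J x (D (ext v) x u))

/-- The one-form `η̂` with `η_u v = η̂(u) J v`, where `η = (∇̄ - ∇) - ξ`: since the trace of `ξ_u J`
is zero and that of `J J` is `-2n`, one has `η̂(u) = - tr ((∇̄ - ∇)_u J) / 2n`. -/
def etaHat (S : SpecialAlmostHermitian n I M) (D Dbar : Connection I M) (x : M)
    (u : TangentSpace I x) : ℝ :=
  -(1 / (2 * n : ℝ)) * LinearMap.trace ℝ (TangentSpace I x)
    ((diff D Dbar x u ∘L S.J x : _ →L[ℝ] _) : _ →ₗ[ℝ] _)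

/-- The exterior derivative of a one-form `a`:
`da(X, Y) = X (a Y) - Y (a X) - a [X, Y]`. -/
def dOne (a : Π x : M, TangentSpace I x → ℝ) (x : M)
    (u v : TangentSpace I x) : ℝ :=
  d% (fun y ↦ a y (ext v y)) x u - d% (fun y ↦ a y (ext u y)) x v
    - a x (mlieBracket I (ext u) (ext v) x)

/-- The minimal `U(n)`-connection `∇̃ = ∇ + ξ`; `nablaTilde S D Y x u = (∇̃_u Y)(x)`. -/
def nablaTilde (S : SpecialAlmostHermitian n I M) (D : Connection I M)
    (Y : Π x : M, TangentSpace I x) (x : M) (u : TangentSpace I x) :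
    TangentSpace I x :=
  D Y x u + xi S D x u (Y x)

/-- The tensor `(∇̃_u ξ)_v w = ∇̃_u (ξ_v w) - ξ_{∇̃_u v} w - ξ_v (∇̃_u w)`. -/
def nablaXi (S : SpecialAlmostHermitian n I M) (D : Connection I M) (x : M)
    (u v w : TangentSpace I x) : TangentSpace I x :=
  nablaTilde S D (fun y ↦ xi S D y (ext v y) (ext w y)) x u
    - xi S D x (nablaTilde S D (ext v) x u) w
    - xi S D x v (nablaTilde S D (ext w) x u)

/-- The curvature operator `R_{X,Y} Z = ∇_{[X,Y]} Z - ∇_X ∇_Y Z + ∇_Y ∇_X Z` on vector fields. -/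
def curvatureOp (D : Connection I M) (X Y Z : Π x : M, TangentSpace I x) (x : M) :
    TangentSpace I x :=
  D Z x (mlieBracket I X Y x)
    - D (fun y ↦ D Z y (Y y)) x (X x) + D (fun y ↦ D Z y (X y)) x (Y x)

/-- The curvature tensor `R(u, v, w, z) = ⟨R_{u,v} w, z⟩` at `x`. -/
def riem (D : Connection I M) (x : M) (u v w z : TangentSpace I x) : ℝ :=
  inner ℝ (curvatureOp D (ext u) (ext v) (ext w) x) z

/-- The Ricci curvature `Ric(u, v) = ∑ᵢ ⟨R_{u,eᵢ} v, eᵢ⟩`, `e` an orthonormal basis. -/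
def ric (D : Connection I M) (x : M)
    (e : OrthonormalBasis (Fin (2 * n)) ℝ (TangentSpace I x))
    (u v : TangentSpace I x) : ℝ :=
  ∑ i, riem D x u (e i) v (e i)

/-- The `*`-Ricci curvature `Ric*(u, v) = ∑ᵢ ⟨R_{u,eᵢ} Jv, Jeᵢ⟩`, `e` an orthonormal basis. -/
def ricStar (S : SpecialAlmostHermitian n I M) (D : Connection I M) (x : M)
    (e : OrthonormalBasis (Fin (2 * n)) ℝ (TangentSpace I x))
    (u v : TangentSpace I x) : ℝ :=
  ∑ i, riem D x u (e i) (S.J x v) (S.J x (e i))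

/-- The expression in `dη̂`, `∇̃ξ` and `ξ` (the intrinsic `SU(n)`-torsion `η + ξ` and its
derivatives) that gives `3 Ric*_H + Ric_H`. -/
def torsionForm (S : SpecialAlmostHermitian n I M) (D Dbar : Connection I M) (x : M)
    (e : OrthonormalBasis (Fin (2 * n)) ℝ (TangentSpace I x))
    (X Y : TangentSpace I x) : ℝ :=
  let J := S.J x
  let ξ := xi S D x
  let dξ := nablaXi S D x
  let dη := dOne (etaHat S D Dbar) x
  2 * n * dη X (J Y) - 2 * n * dη (J X) Y
    + ∑ i, (
      - inner ℝ (dξ (e i) X Y) (e i) + inner ℝ (dξ X (e i) Y) (e i)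
      - inner ℝ (dξ (e i) (J X) (J Y)) (e i) + inner ℝ (dξ (J X) (e i) (J Y)) (e i)
      - inner ℝ (ξ (ξ (e i) X) Y) (e i) + inner ℝ (ξ (ξ X (e i)) Y) (e i)
      - inner ℝ (ξ (ξ (e i) (J X)) (J Y)) (e i) + inner ℝ (ξ (ξ (J X) (e i)) (J Y)) (e i)
      - 2 * inner ℝ (ξ X (e i)) (ξ (J Y) (J (e i)))
      - 2 * inner ℝ (ξ Y (e i)) (ξ (J X) (J (e i))))

end Manifold

/-! ## Kähler curvature tensors on a Hermitian vector space

`V` is a real inner product space with an orthogonal complex structure `J` and an orthonormal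
basis `e`; in the theorem `V` is a tangent space. -/

section Algebra

variable {V : Type*} [NormedAddCommGroup V] [InnerProductSpace ℝ V] {n : ℕ}

/-- The Hermitian part `b_H` of a bilinear form `b`. -/
def hermPart (J : V → V) (b : V → V → ℝ) (u v : V) : ℝ :=
  (b u v + b (J u) (J v)) / 2

/-- The trace of a bilinear form. -/
def tr (e : OrthonormalBasis (Fin (2 * n)) ℝ V) (b : V → V → ℝ) : ℝ :=
  ∑ i, b (e i) (e i)

/-- Algebraic curvature tensors: quadrilinear forms with the symmetries of a Riemannian curvature
tensor. (Linearity in the other arguments follows from the symmetries.) -/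
structure IsCurvature (K : V → V → V → V → ℝ) : Prop where
  add : ∀ a a' b c d, K (a + a') b c d = K a b c d + K a' b c d
  smul : ∀ (t : ℝ) a b c d, K (t • a) b c d = t * K a b c d
  antisymm : ∀ a b c d, K b a c d = -K a b c d
  pair_symm : ∀ a b c d, K c d a b = K a b c d
  bianchi : ∀ a b c d, K a b c d + K b c a d + K c a b d = 0

/-- The space `𝒦` of Kähler curvature tensors: those with values in `u(n)`. -/
structure IsKahler (J : V → V) (K : V → V → V → V → ℝ) : Prop extends IsCurvature K where
  commute : ∀ a b c d, K a b (J c) (J d) = K a b c d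

/-- Kähler curvature tensors with values in `su(n)`. -/
structure IsCurSU (J : V → V) (e : OrthonormalBasis (Fin (2 * n)) ℝ V)
    (K : V → V → V → V → ℝ) : Prop extends IsKahler J K where
  traceless : ∀ a b, ∑ i, K a b (e i) (J (e i)) = 0

/-- The inner product of two four-tensors. -/
def pair (e : OrthonormalBasis (Fin (2 * n)) ℝ V) (K L : V → V → V → V → ℝ) : ℝ :=
  ∑ i, ∑ j, ∑ k, ∑ l, K (e i) (e j) (e k) (e l) * L (e i) (e j) (e k) (e l)

/-- The trivial `U(n)`-summand `𝒦₁` of `𝒦`: the `U(n)`-invariant Kähler curvature tensors that are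
orthogonal to those with values in `su(n)`. -/
structure IsK1 (J : V → V) (e : OrthonormalBasis (Fin (2 * n)) ℝ V)
    (K : V → V → V → V → ℝ) : Prop extends IsKahler J K where
  perp_su : ∀ B, IsCurSU J e B → pair e K B = 0
  invariant : ∀ g : V ≃ₗᵢ[ℝ] V, (∀ v, g (J v) = J (g v)) →
    ∀ a b c d, K (g a) (g b) (g c) (g d) = K a b c d

/-- The summand `𝒦₂` of `𝒦`: the orthogonal complement in `𝒦` of `𝒦₁` and of the curvature tensors
with values in `su(n)`. -/
structure IsK2 (J : V → V) (e : OrthonormalBasis (Fin (2 * n)) ℝ V)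
    (K : V → V → V → V → ℝ) : Prop extends IsKahler J K where
  perp_su : ∀ B, IsCurSU J e B → pair e K B = 0
  perp_K1 : ∀ B, IsK1 J e B → pair e K B = 0

/-- `A` is the component of `R` in the space of four-tensors described by `P`, that is, its
orthogonal projection. -/
def IsComponent (e : OrthonormalBasis (Fin (2 * n)) ℝ V)
    (P : (V → V → V → V → ℝ) → Prop) (R A : V → V → V → V → ℝ) : Prop :=
  P A ∧ ∀ B, P B → pair e (fun a b c d ↦ R a b c d - A a b c d) B = 0

/-- The Kähler curvature tensor `Φ(b)` built from a symmetric Hermitian form `b`, where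
`ω(u, v) = ⟨u, J v⟩` and `β(u, v) = b(u, J v)`. -/
def kahlerOf (J : V → V) (b : V → V → ℝ) (x y z w : V) : ℝ :=
  let g : V → V → ℝ := fun u v ↦ inner ℝ u v
  let om : V → V → ℝ := fun u v ↦ inner ℝ u (J v)
  let β : V → V → ℝ := fun u v ↦ b u (J v)
  g x z * b y w + b x z * g y w - g y z * b x w - b y z * g x w
    + om x z * β y w + β x z * om y w - om y z * β x w - β y z * om x w
    + 2 * om x y * β z w + 2 * β x y * om z w

end Algebra

end SAH

end

/-! The proof compares the curvature of `∇` with that of `∇̄`. The difference `∇̄ - ∇` splits into a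
part anticommuting with `J`, which is `ξ` because `∇̄J = 0`, and a part commuting with `J`, which is
a multiple `η̂ ⊗ J` because the difference is orthogonal to `su(n)` (`diff_eq_xi_add_etaHat`).
Substitution into the curvature gives (`curvatureOp_eq`) `R_{u,v} = R̄_{u,v} + dη̂(u,v) J + (∇̃_u
ξ)_v - (∇̃_v ξ)_u + ξ_{ξ_u v} - ξ_{ξ_v u} - [ξ_u, ξ_v]`, and `R̄` is `su(n)`-valued since `J` and
`Ψ` are parallel for `∇̄` (`curvatureOp_J`, `sum_inner_curvatureOp_J`).

Two contractions do not see `R̄`. The trace of `R_{u,v}` against `J`, which equals `2 Ric*(u, -Jv)`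
by the Bianchi identity, involves only `dη̂` and `[ξ_u, ξ_v]`; the difference `Ric - Ric*` involves
only the terms anticommuting with `J`. Since `3 Ric* + Ric = 4 Ric* + (Ric - Ric*)`, the Hermitian
part is expressed by the torsion (`three_ricciStar_add_ricci`).

For the projections, a Kähler tensor is `su(n)`-valued exactly when it is Ricci-flat, so those
orthogonal to all such tensors are the `Φ(b)` (`IsKahler.eq_kahlerOf`). Complex reflections act
transitively enough to show that `𝒦₁` is spanned by `Φ(g)`, and `𝒦₂` is then given by trace-free
`b`. The pairings `⟨R, Φ(b)⟩ = 4⟨T, b⟩` (`pair_kahlerOf_hermPart`) and `⟨Φ(b), Φ(b')⟩ = 16(tr b tr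
b' + (2n+4)⟨b, b'⟩)` (`pair_kahlerOf_kahlerOf`) yield the constants. -/

noncomputable section

namespace SAH

/-! ### Traces, curvature symmetries and Ricci contractions on a Hermitian vector space. -/

section HermitianAlgebra

variable {V : Type*} [NormedAddCommGroup V] [InnerProductSpace ℝ V] {n : ℕ}

/-- `J` is an orthogonal complex structure. -/
structure IsOrthComplex (J : V →L[ℝ] V) : Prop where
  sq : ∀ v, J (J v) = -v
  inner_map : ∀ v w, inner ℝ (J v) (J w) = inner ℝ v w

/-- Bilinearity from linearity in each argument. -/
theorem isBilinearMap_of {f : V → V → ℝ} (h₁ : ∀ v, IsLinearMap ℝ fun u ↦ f u v)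
    (h₂ : ∀ u, IsLinearMap ℝ (f u)) : IsBilinearMap ℝ f where
  add_left u u' v := (h₁ v).map_add u u'
  smul_left t u v := (h₁ v).map_smul t u
  add_right u v v' := (h₂ u).map_add v v'
  smul_right t u v := (h₂ u).map_smul t v

theorem _root_.IsBilinearMap.isLinearMap_left {f : V → V → ℝ} (hf : IsBilinearMap ℝ f) (v : V) :
    IsLinearMap ℝ fun u ↦ f u v := ⟨fun _ _ ↦ hf.add_left _ _ _, fun _ _ ↦ hf.smul_left _ _ _⟩

theorem _root_.IsBilinearMap.isLinearMap_right {f : V → V → ℝ} (hf : IsBilinearMap ℝ f) (u : V) :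
    IsLinearMap ℝ (f u) := ⟨fun _ _ ↦ hf.add_right _ _ _, fun _ _ ↦ hf.smul_right _ _ _⟩

theorem isLinearMap_comp {f : V → ℝ} (hf : IsLinearMap ℝ f) (J : V →L[ℝ] V) :
    IsLinearMap ℝ fun v ↦ f (J v) :=
  ⟨fun u v ↦ by rw [map_add, hf.map_add], fun t u ↦ by rw [map_smul, hf.map_smul]⟩

theorem isLinearMap_mul_const {f : V → ℝ} (hf : IsLinearMap ℝ f) (c : ℝ) :
    IsLinearMap ℝ fun v ↦ f v * c :=
  ⟨fun u v ↦ by rw [hf.map_add, add_mul], fun t u ↦ by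
    rw [hf.map_smul, smul_eq_mul, smul_eq_mul, mul_assoc]⟩

theorem isLinearMap_const_mul {f : V → ℝ} (hf : IsLinearMap ℝ f) (c : ℝ) :
    IsLinearMap ℝ fun v ↦ c * f v := by
  simpa only [mul_comm c] using isLinearMap_mul_const hf c

theorem isLinearMap_sum {ι : Type*} [Fintype ι] {f : ι → V → ℝ} (hf : ∀ i, IsLinearMap ℝ (f i)) :
    IsLinearMap ℝ fun v ↦ ∑ i, f i v :=
  ⟨fun u v ↦ by simp only [(hf _).map_add, Finset.sum_add_distrib],
    fun t u ↦ by simp only [(hf _).map_smul, Finset.smul_sum]⟩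

theorem isBilinearMap_inner : IsBilinearMap ℝ fun u v : V ↦ (inner ℝ u v : ℝ) where
  add_left := inner_add_left
  smul_left t u v := by simp [real_inner_smul_left]
  add_right := inner_add_right
  smul_right t u v := by simp [real_inner_smul_right]

variable {ι : Type*} [Fintype ι]

theorem sum_inner_basis_mul (e : OrthonormalBasis ι ℝ V) {f : V → ℝ} (hf : IsLinearMap ℝ f)
    (v : V) : ∑ i, inner ℝ (e i) v * f (e i) = f v := by
  conv_rhs => rw [← e.sum_repr' v]
  rw [show f = hf.mk' f from rfl, map_sum]
  simp

theorem sum_inner_basis_mul' (e : OrthonormalBasis ι ℝ V) {f : V → ℝ} (hf : IsLinearMap ℝ f)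
    (v : V) : ∑ i, inner ℝ v (e i) * f (e i) = f v := by
  simp only [real_inner_comm (e _) v]
  exact sum_inner_basis_mul e hf v

/-- The trace of a bilinear form does not depend on the orthonormal basis. -/
theorem sum_basis_eq {κ : Type*} [Fintype κ] {f : V → V → ℝ} (hf : IsBilinearMap ℝ f)
    (e : OrthonormalBasis ι ℝ V) (e' : OrthonormalBasis κ ℝ V) :
    ∑ i, f (e i) (e i) = ∑ i, f (e' i) (e' i) := by
  have h1 : ∀ i, f (e i) (e i) = ∑ j, inner ℝ (e i) (e' j) * f (e' j) (e i) := fun i ↦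
    (sum_inner_basis_mul' e' (hf.isLinearMap_left _) (e i)).symm
  simp only [h1]
  rw [Finset.sum_comm]
  refine Finset.sum_congr rfl fun j _ ↦ ?_
  exact sum_inner_basis_mul e (hf.isLinearMap_right _) (e' j)

namespace IsOrthComplex

variable {J : V →L[ℝ] V}

/-- `J` as an isometry. -/
def isometry (hJ : IsOrthComplex J) : V ≃ₗᵢ[ℝ] V where
  toFun := J
  invFun := fun v ↦ -J v
  left_inv v := by simp [hJ.sq]
  right_inv v := by simp [hJ.sq]
  map_add' := map_add J
  map_smul' := map_smul J
  norm_map' v := by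
    simp only [LinearEquiv.coe_mk, LinearMap.coe_mk, AddHom.coe_mk]
    rw [@norm_eq_sqrt_real_inner V, @norm_eq_sqrt_real_inner V, hJ.inner_map]

/-- `J` carries an orthonormal basis to another one, and traces do not depend on the basis. This
substitution of `J eᵢ` for `eᵢ` is what moves `J` between arguments under a sum. -/
theorem sum_basis (hJ : IsOrthComplex J) (e : OrthonormalBasis ι ℝ V) {f : V → V → ℝ}
    (hf : IsBilinearMap ℝ f) : ∑ i, f (J (e i)) (J (e i)) = ∑ i, f (e i) (e i) := by
  rw [sum_basis_eq hf e (e.map hJ.isometry)]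
  rfl

theorem inner_right (hJ : IsOrthComplex J) (u v : V) : inner ℝ u (J v) = -inner ℝ (J u) v := by
  rw [← hJ.inner_map u (J v), hJ.sq, inner_neg_right]

theorem inner_self (hJ : IsOrthComplex J) (u : V) : inner ℝ u (J u) = 0 := by
  have := hJ.inner_right u u
  rw [real_inner_comm] at this
  rw [real_inner_comm]
  linarith

end IsOrthComplex

theorem isLinearMap_neg {f : V → ℝ} (hf : IsLinearMap ℝ f) : IsLinearMap ℝ fun v ↦ -f v := by
  simpa using isLinearMap_const_mul hf (-1)

namespace IsCurvature

variable {R S : V → V → V → V → ℝ}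

theorem lin₁ (hR : IsCurvature R) (b c d : V) : IsLinearMap ℝ fun a ↦ R a b c d :=
  ⟨fun _ _ ↦ hR.add _ _ _ _ _, fun _ _ ↦ hR.smul _ _ _ _ _⟩

theorem lin₂ (hR : IsCurvature R) (a c d : V) : IsLinearMap ℝ fun b ↦ R a b c d := by
  simp only [fun b ↦ hR.antisymm b a c d]
  exact isLinearMap_neg (hR.lin₁ _ _ _)

theorem lin₃ (hR : IsCurvature R) (a b d : V) : IsLinearMap ℝ fun c ↦ R a b c d := by
  simp only [fun c ↦ (hR.pair_symm a b c d).symm]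
  exact hR.lin₁ _ _ _

theorem lin₄ (hR : IsCurvature R) (a b c : V) : IsLinearMap ℝ fun d ↦ R a b c d := by
  simp only [fun d ↦ (hR.pair_symm a b c d).symm]
  exact hR.lin₂ _ _ _

theorem antisymm' (hR : IsCurvature R) (a b c d : V) : R a b d c = -R a b c d := by
  rw [← hR.pair_symm, hR.antisymm, hR.pair_symm]

theorem flip (hR : IsCurvature R) (a b c d : V) : R b a d c = R a b c d := by
  rw [hR.antisymm, hR.antisymm', neg_neg]

theorem neg₂ (hR : IsCurvature R) (a b c d : V) : R a (-b) c d = -R a b c d :=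
  (hR.lin₂ a c d).map_neg b

theorem neg₄ (hR : IsCurvature R) (a b c d : V) : R a b c (-d) = -R a b c d :=
  (hR.lin₄ a b c).map_neg d

theorem eq_zero_of_basis (hR : IsCurvature R) (e : OrthonormalBasis ι ℝ V)
    (h : ∀ i j k l, R (e i) (e j) (e k) (e l) = 0) (a b c d : V) : R a b c d = 0 := by
  rw [← sum_inner_basis_mul e (hR.lin₁ b c d)]
  refine Finset.sum_eq_zero fun i _ ↦ ?_
  rw [← sum_inner_basis_mul e (hR.lin₂ _ c d)]
  rw [Finset.sum_eq_zero, mul_zero]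
  intro j _
  rw [← sum_inner_basis_mul e (hR.lin₃ _ _ d)]
  rw [Finset.sum_eq_zero, mul_zero]
  intro k _
  rw [← sum_inner_basis_mul e (hR.lin₄ _ _ _)]
  rw [Finset.sum_eq_zero, mul_zero]
  intro l _
  rw [h, mul_zero]

theorem add_smul (hR : IsCurvature R) (hS : IsCurvature S) (t : ℝ) :
    IsCurvature fun a b c d ↦ R a b c d + t * S a b c d where
  add a a' b c d := by rw [hR.add, hS.add]; ring
  smul s a b c d := by rw [hR.smul, hS.smul]; ring
  antisymm a b c d := by rw [hR.antisymm, hS.antisymm]; ring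
  pair_symm a b c d := by rw [hR.pair_symm, hS.pair_symm]
  bianchi a b c d := by linear_combination hR.bianchi a b c d + t * hS.bianchi a b c d

end IsCurvature

/-- The Ricci contraction of a four-tensor. -/
def ricciOf (e : OrthonormalBasis ι ℝ V) (R : V → V → V → V → ℝ) (u v : V) : ℝ :=
  ∑ i, R u (e i) v (e i)

/-- The `*`-Ricci contraction of a four-tensor. -/
def ricciStarOf (J : V →L[ℝ] V) (e : OrthonormalBasis ι ℝ V) (R : V → V → V → V → ℝ)
    (u v : V) : ℝ :=
  ∑ i, R u (e i) (J v) (J (e i))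

section Contractions

variable {J : V →L[ℝ] V} {R : V → V → V → V → ℝ} (e : OrthonormalBasis ι ℝ V)

theorem IsCurvature.isBilinearMap_ricciOf (hR : IsCurvature R) :
    IsBilinearMap ℝ (ricciOf e R) :=
  isBilinearMap_of (fun _ ↦ isLinearMap_sum fun _ ↦ hR.lin₁ _ _ _)
    (fun _ ↦ isLinearMap_sum fun _ ↦ hR.lin₃ _ _ _)

theorem IsCurvature.isBilinearMap_ricciStarOf (hR : IsCurvature R) :
    IsBilinearMap ℝ (ricciStarOf J e R) :=
  isBilinearMap_of (fun _ ↦ isLinearMap_sum fun _ ↦ hR.lin₁ _ _ _)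
    (fun _ ↦ isLinearMap_sum fun _ ↦ isLinearMap_comp (hR.lin₃ _ _ _) J)

theorem IsCurvature.ricciOf_symm (hR : IsCurvature R) (u v : V) :
    ricciOf e R u v = ricciOf e R v u :=
  Finset.sum_congr rfl fun _ _ ↦ hR.pair_symm _ _ _ _

theorem IsCurvature.ricciStarOf_eq (hR : IsCurvature R) (hJ : IsOrthComplex J) (u v : V) :
    ricciStarOf J e R u v = ∑ i, R u (J (e i)) (e i) (J v) := by
  rw [ricciStarOf, ← hJ.sum_basis e (f := fun a b ↦ R u a (J v) (J b))]
  · exact Finset.sum_congr rfl fun i _ ↦ by rw [hJ.sq, hR.neg₄, ← hR.antisymm']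
  · exact isBilinearMap_of (fun _ ↦ hR.lin₂ _ _ _) (fun _ ↦ isLinearMap_comp (hR.lin₄ _ _ _) J)

/-- In general `Ric*` is neither symmetric nor `J`-invariant; `J` exchanges its arguments. Hence its
Hermitian part is also its symmetric part. -/
theorem IsCurvature.ricciStarOf_J (hR : IsCurvature R) (hJ : IsOrthComplex J) (u v : V) :
    ricciStarOf J e R (J u) (J v) = ricciStarOf J e R v u := by
  rw [hR.ricciStarOf_eq e hJ, ricciStarOf]
  refine Finset.sum_congr rfl fun i _ ↦ ?_
  rw [hJ.sq, hR.neg₄, ← hR.pair_symm, hR.antisymm', neg_neg, hR.antisymm, ← hR.antisymm']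

/-- The Bianchi identity splits the right-hand summand into two terms, which have the same sum after
replacing `eᵢ` by `J eᵢ`. This identifies the trace of the curvature against `J` with `Ric*`. -/
theorem IsCurvature.two_ricciStarOf (hR : IsCurvature R) (hJ : IsOrthComplex J) (u v : V) :
    2 * ricciStarOf J e R u v = ∑ i, R u (J v) (e i) (J (e i)) := by
  have h : ∑ i, R (e i) (J v) u (J (e i)) = ricciStarOf J e R u v := by
    rw [← hJ.sum_basis e (f := fun a b ↦ R a (J v) u (J b))]
    · exact Finset.sum_congr rfl fun i _ ↦ by
        rw [hJ.sq, hR.neg₄, ← hR.antisymm', ← hR.pair_symm, hR.flip]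
    · exact isBilinearMap_of (fun _ ↦ hR.lin₁ _ _ _) (fun _ ↦ isLinearMap_comp (hR.lin₄ _ _ _) J)
  have h2 : ∀ i, R u (J v) (e i) (J (e i))
      = R u (e i) (J v) (J (e i)) + R (e i) (J v) u (J (e i)) := fun i ↦ by
    have := hR.bianchi u (e i) (J v) (J (e i))
    rw [hR.antisymm u (J v)] at this
    linarith
  simp only [h2, Finset.sum_add_distrib, h]
  rw [ricciStarOf]; ring

end Contractions

end HermitianAlgebra

/-! ### The tensors `Φ(b)` and their pairing with curvature tensors. -/

section KahlerCurvature

variable {V : Type*} [NormedAddCommGroup V] [InnerProductSpace ℝ V] {n : ℕ}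
  {J : V →L[ℝ] V} {R K L : V → V → V → V → ℝ} {b b' : V → V → ℝ}
  (e : OrthonormalBasis (Fin (2 * n)) ℝ V)

/-- Symmetric bilinear forms of type `(1, 1)`. -/
structure IsHermForm (J : V →L[ℝ] V) (b : V → V → ℝ) : Prop extends IsBilinearMap ℝ b where
  symm : ∀ u v, b u v = b v u
  herm : ∀ u v, b (J u) (J v) = b u v

theorem IsHermForm.apply_J_left (hb : IsHermForm J b) (hJ : IsOrthComplex J) (u v : V) :
    b (J u) v = -b u (J v) := by
  rw [← hb.herm, hJ.sq, (hb.isLinearMap_left _).map_neg]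

theorem isHermForm_inner (hJ : IsOrthComplex J) :
    IsHermForm J fun u v : V ↦ (inner ℝ u v : ℝ) where
  toIsBilinearMap := isBilinearMap_inner
  symm _ _ := real_inner_comm _ _
  herm := hJ.inner_map

theorem IsHermForm.add_smul (hb : IsHermForm J b) (hb' : IsHermForm J b') (s t : ℝ) :
    IsHermForm J fun u v ↦ s * b u v + t * b' u v where
  add_left u u' v := by rw [hb.add_left, hb'.add_left]; ring
  smul_left c u v := by rw [hb.smul_left, hb'.smul_left]; simp only [smul_eq_mul]; ring
  add_right u u' v := by rw [hb.add_right, hb'.add_right]; ring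
  smul_right c u v := by rw [hb.smul_right, hb'.smul_right]; simp only [smul_eq_mul]; ring
  symm u v := by rw [hb.symm, hb'.symm]
  herm u v := by rw [hb.herm, hb'.herm]

theorem kahlerOf_add_smul (s t : ℝ) (x y z w : V) :
    kahlerOf J (fun u v ↦ s * b u v + t * b' u v) x y z w =
      s * kahlerOf J b x y z w + t * kahlerOf J b' x y z w := by
  simp only [kahlerOf]; ring

/-- The forms `g`, `b` are symmetric and `ω`, `β` are skew; once every factor has a fixed order of
arguments, the symmetries are polynomial identities. Replacing `z, w` by `Jz, Jw` exchanges the four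
`g b` terms with the four `ω β` terms and fixes the last two. -/
theorem isKahler_kahlerOf (hJ : IsOrthComplex J) (hb : IsHermForm J b) :
    IsKahler J (kahlerOf J b) where
  add a a' c d f := by
    simp only [kahlerOf, inner_add_left, hb.add_left]; ring
  smul t a c d f := by
    simp only [kahlerOf, real_inner_smul_left, hb.smul_left, smul_eq_mul]; ring
  antisymm x y z w := by
    have h1 : inner ℝ y (J x) = -inner ℝ x (J y) := by
      rw [hJ.inner_right, real_inner_comm]
    have h2 : b y (J x) = -b x (J y) := by rw [hb.symm, hb.apply_J_left hJ]
    simp only [kahlerOf, h1, h2]; ring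
  pair_symm x y z w := by
    have h1 : ∀ u v : V, inner ℝ u (J v) = -inner ℝ v (J u) := fun u v ↦ by
      rw [hJ.inner_right, real_inner_comm]
    have h2 : ∀ u v, b u (J v) = -b v (J u) := fun u v ↦ by rw [hb.symm, hb.apply_J_left hJ]
    simp only [kahlerOf]
    rw [h1 z x, h1 w y, h1 w x, h1 z y, h2 z x, h2 w y, h2 w x, h2 z y, hb.symm z x, hb.symm w y,
      hb.symm w x, hb.symm z y, real_inner_comm x z, real_inner_comm y w, real_inner_comm x w,
      real_inner_comm y z]
    ring
  bianchi x y z w := by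
    have h1 : ∀ u v : V, inner ℝ u (J v) = -inner ℝ v (J u) := fun u v ↦ by
      rw [hJ.inner_right, real_inner_comm]
    have h2 : ∀ u v, b u (J v) = -b v (J u) := fun u v ↦ by rw [hb.symm, hb.apply_J_left hJ]
    simp only [kahlerOf]
    rw [h1 y x, h1 z y, h1 z x, h2 y x, h2 z y, h2 z x, hb.symm y x, hb.symm z y, hb.symm z x,
      real_inner_comm x y, real_inner_comm y z, real_inner_comm x z]
    ring
  commute x y z w := by
    have h1 : ∀ u v : V, inner ℝ u (J v) = -inner ℝ (J u) v := hJ.inner_right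
    have h2 : ∀ u v, b u (J v) = -b (J u) v := fun u v ↦ by rw [hb.apply_J_left hJ, neg_neg]
    simp only [kahlerOf, h1, h2, hJ.sq, inner_neg_right, (hb.isLinearMap_right _).map_neg]
    ring

theorem pair_comm : pair e K L = pair e L K := by simp only [pair, mul_comm]

theorem pair_sub_smul (t : ℝ) : pair e (fun a b c d ↦ R a b c d - t * K a b c d) L =
    pair e R L - t * pair e K L := by
  simp only [pair, sub_mul, Finset.sum_sub_distrib, Finset.mul_sum, mul_assoc]

theorem pair_add_right : pair e R (fun a b c d ↦ K a b c d + L a b c d) =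
    pair e R K + pair e R L := by
  simp only [pair, mul_add, Finset.sum_add_distrib]

theorem pair_sub_right : pair e R (fun a b c d ↦ K a b c d - L a b c d) =
    pair e R K - pair e R L := by
  simp only [pair, mul_sub, Finset.sum_sub_distrib]

theorem pair_smul_right (t : ℝ) : pair e R (fun a b c d ↦ t * K a b c d) = t * pair e R K := by
  simp only [pair, Finset.mul_sum, mul_left_comm]

/-- Relabelling the summation indices transfers a symmetry of `R` to its partner in the pairing;
likewise for the next two lemmas. -/
theorem pair_swap_left (hR : IsCurvature R) (L : V → V → V → V → ℝ) :
    pair e R (fun x y z w ↦ L y x z w) = -pair e R L := by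
  simp only [pair, ← Finset.sum_neg_distrib, ← neg_mul, ← hR.antisymm]
  exact Finset.sum_comm

theorem pair_swap_right (hR : IsCurvature R) (L : V → V → V → V → ℝ) :
    pair e R (fun x y z w ↦ L x y w z) = -pair e R L := by
  simp only [pair, ← Finset.sum_neg_distrib, ← neg_mul, ← hR.antisymm']
  exact Finset.sum_congr rfl fun _ _ ↦ Finset.sum_congr rfl fun _ _ ↦ Finset.sum_comm

theorem pair_swap_pairs (hR : IsCurvature R) (L : V → V → V → V → ℝ) :
    pair e R (fun x y z w ↦ L z w x y) = pair e R L := by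
  have h : ∀ F : Fin (2 * n) → Fin (2 * n) → Fin (2 * n) → Fin (2 * n) → ℝ,
      ∑ i, ∑ j, ∑ k, ∑ l, F i j k l = ∑ i, ∑ j, ∑ k, ∑ l, F k l i j := fun F ↦ by
    have move : ∀ G : Fin (2 * n) → Fin (2 * n) → Fin (2 * n) → ℝ,
        ∑ i, ∑ k, ∑ l, G i k l = ∑ k, ∑ l, ∑ i, G i k l := fun G ↦ by
      rw [Finset.sum_comm]
      exact Finset.sum_congr rfl fun _ _ ↦ Finset.sum_comm
    simp only [move (F _)]
    rw [move fun i k l ↦ ∑ j, F i j k l]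
  rw [pair, pair, h]
  simp only [hR.pair_symm]

/-- The pairing of a curvature tensor with `Φ(b)` only involves its Ricci contractions. -/
theorem pair_kahlerOf (hJ : IsOrthComplex J) (hR : IsCurvature R) (hb : IsHermForm J b) :
    pair e R (kahlerOf J b) =
      4 * ∑ i, ∑ j, (ricciOf e R (e i) (e j) + 3 * ricciStarOf J e R (e i) (e j)) *
        b (e i) (e j) := by
  -- The ten terms of `Φ(b)` come from three model tensors by permutations of the arguments under
  -- which `R` is invariant up to sign.
  have key : kahlerOf J b = fun x y z w ↦
      (fun x y z w ↦ inner ℝ x z * b y w) x y z w + (fun x y z w ↦ inner ℝ x z * b y w) y x w z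
      - (fun x y z w ↦ inner ℝ x z * b y w) y x z w - (fun x y z w ↦ inner ℝ x z * b y w) x y w z
      + (fun x y z w ↦ inner ℝ x (J z) * b y (J w)) x y z w
      + (fun x y z w ↦ inner ℝ x (J z) * b y (J w)) y x w z
      - (fun x y z w ↦ inner ℝ x (J z) * b y (J w)) y x z w
      - (fun x y z w ↦ inner ℝ x (J z) * b y (J w)) x y w z
      + 2 * (fun x y z w ↦ inner ℝ x (J y) * b z (J w)) x y z w
      + 2 * (fun x y z w ↦ inner ℝ x (J y) * b z (J w)) z w x y := by
    funext x y z w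
    simp only [kahlerOf]; ring
  have hP : pair e R (fun x y z w ↦ inner ℝ x z * b y w) =
      ∑ i, ∑ j, ricciOf e R (e i) (e j) * b (e i) (e j) := by
    simp only [pair]
    rw [Finset.sum_comm]
    refine Finset.sum_congr rfl fun j _ ↦ ?_
    have : ∀ i, ∑ k, ∑ l, R (e i) (e j) (e k) (e l) * (inner ℝ (e i) (e k) * b (e j) (e l)) =
        ∑ l, R (e i) (e j) (e i) (e l) * b (e j) (e l) := fun i ↦ by
      rw [Finset.sum_comm]
      refine Finset.sum_congr rfl fun l _ ↦ ?_
      rw [← sum_inner_basis_mul' e (hR.lin₃ (e i) (e j) (e l)) (e i), Finset.sum_mul]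
      exact Finset.sum_congr rfl fun k _ ↦ by ring
    simp only [this]
    rw [Finset.sum_comm]
    refine Finset.sum_congr rfl fun l _ ↦ ?_
    rw [← Finset.sum_mul, ricciOf]
    congr 1
    exact Finset.sum_congr rfl fun i _ ↦ (hR.flip _ _ _ _).symm
  -- Replacing `e l` by `J (e l)` moves `J` off `b` at the cost of a sign.
  have hJl : ∀ (f : V → ℝ) (_ : IsLinearMap ℝ f) (u : V),
      ∑ l, f (e l) * b u (J (e l)) = -∑ l, f (J (e l)) * b u (e l) := fun f hf u ↦ by
    rw [← hJ.sum_basis e (f := fun x y ↦ f x * b u (J y)), ← Finset.sum_neg_distrib]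
    · refine Finset.sum_congr rfl fun l _ ↦ ?_
      rw [hJ.sq, (hb.isLinearMap_right _).map_neg, mul_neg]
    · exact isBilinearMap_of (fun _ ↦ isLinearMap_mul_const hf _)
        (fun _ ↦ isLinearMap_const_mul (isLinearMap_comp (hb.isLinearMap_right _) J) _)
  have hQ : pair e R (fun x y z w ↦ inner ℝ x (J z) * b y (J w)) =
      ∑ i, ∑ j, ricciStarOf J e R (e i) (e j) * b (e i) (e j) := by
    simp only [pair]
    rw [Finset.sum_comm]
    refine Finset.sum_congr rfl fun j _ ↦ ?_
    rw [Finset.sum_comm]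
    have : ∀ k, ∑ i, ∑ l, R (e i) (e j) (e k) (e l) * (inner ℝ (e i) (J (e k)) * b (e j) (J (e l)))
        = ∑ l, R (e j) (J (e k)) (e k) (J (e l)) * b (e j) (e l) := fun k ↦ by
      rw [Finset.sum_comm]
      calc _ = ∑ l, R (J (e k)) (e j) (e k) (e l) * b (e j) (J (e l)) := by
            refine Finset.sum_congr rfl fun l _ ↦ ?_
            rw [← sum_inner_basis_mul e (hR.lin₁ (e j) (e k) (e l)), Finset.sum_mul]
            exact Finset.sum_congr rfl fun k _ ↦ by ring
        _ = _ := by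
          rw [hJl _ (hR.lin₄ _ _ _), ← Finset.sum_neg_distrib]
          exact Finset.sum_congr rfl fun l _ ↦ by rw [hR.antisymm, neg_mul, neg_neg]
    simp only [this]
    rw [Finset.sum_comm]
    refine Finset.sum_congr rfl fun l _ ↦ ?_
    rw [← Finset.sum_mul, hR.ricciStarOf_eq e hJ]
  have hW : pair e R (fun x y z w ↦ inner ℝ x (J y) * b z (J w)) =
      ∑ i, ∑ j, 2 * ricciStarOf J e R (e i) (e j) * b (e i) (e j) := by
    rw [← pair_swap_pairs e hR]
    simp only [pair]
    refine Finset.sum_congr rfl fun i _ ↦ ?_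
    have : ∀ j, ∑ k, ∑ l, R (e i) (e j) (e k) (e l) * (inner ℝ (e k) (J (e l)) * b (e i) (J (e j)))
        = (∑ l, R (e i) (e j) (J (e l)) (e l)) * b (e i) (J (e j)) := fun j ↦ by
      rw [Finset.sum_comm, Finset.sum_mul]
      refine Finset.sum_congr rfl fun l _ ↦ ?_
      rw [← sum_inner_basis_mul e (hR.lin₃ (e i) (e j) (e l)), Finset.sum_mul]
      exact Finset.sum_congr rfl fun k _ ↦ by ring
    simp only [this]
    rw [hJl (fun v ↦ ∑ l, R (e i) v (J (e l)) (e l)) (isLinearMap_sum fun _ ↦ hR.lin₂ _ _ _),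
      ← Finset.sum_neg_distrib]
    refine Finset.sum_congr rfl fun j _ ↦ ?_
    rw [hR.two_ricciStarOf e hJ, ← neg_mul, ← Finset.sum_neg_distrib]
    congr 1
    exact Finset.sum_congr rfl fun l _ ↦ by rw [← hR.antisymm']
  -- The first two models count four times each; the third has total weight four and contributes `2
  -- Ric*` each time. The sum is `4 Ric + (4 + 8) Ric*`.
  rw [key]
  simp only [pair_add_right, pair_sub_right, pair_smul_right]
  rw [pair_swap_left e hR (fun x y z w ↦ inner ℝ x z * b y w),
    pair_swap_right e hR (fun x y z w ↦ inner ℝ x z * b y w),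
    pair_swap_left e hR (fun x y w z ↦ inner ℝ x z * b y w),
    pair_swap_right e hR (fun x y z w ↦ inner ℝ x z * b y w),
    pair_swap_left e hR (fun x y z w ↦ inner ℝ x (J z) * b y (J w)),
    pair_swap_right e hR (fun x y z w ↦ inner ℝ x (J z) * b y (J w)),
    pair_swap_left e hR (fun x y w z ↦ inner ℝ x (J z) * b y (J w)),
    pair_swap_right e hR (fun x y z w ↦ inner ℝ x (J z) * b y (J w)),
    pair_swap_pairs e hR (fun x y z w ↦ inner ℝ x (J y) * b z (J w)), hP, hQ, hW]
  simp only [add_mul, mul_assoc, Finset.sum_add_distrib, ← Finset.mul_sum]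
  ring

/-- The `g b` terms contract to `tr b g + (2n - 2) b`, the mixed `ω β` terms to `2 b` and the last
two to `4 b`; terms with `ω(x, x)` or `β(x, x)` vanish. -/
theorem ricciOf_kahlerOf (hJ : IsOrthComplex J) (hb : IsHermForm J b) (u v : V) :
    ricciOf e (kahlerOf J b) u v = tr e b * inner ℝ u v + (2 * n + 4) * b u v := by
  have h0 : ∀ x, b x (J x) = 0 := fun x ↦ by
    have h1 := hb.apply_J_left hJ x x
    rw [hb.symm] at h1
    linarith
  have hterm : ∀ x : V, kahlerOf J b u x v x =
      inner ℝ u v * b x x + b u v * inner ℝ x x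
      - inner ℝ x v * b u x - inner ℝ u x * b x v
      + inner ℝ x (J v) * b (J u) x + inner ℝ (J u) x * b x (J v)
      + 2 * (inner ℝ (J u) x * b (J v) x) + 2 * (inner ℝ (J v) x * b (J u) x) := fun x ↦ by
    simp only [kahlerOf, hJ.inner_self, h0, hb.apply_J_left hJ, hJ.inner_right u x,
      hJ.inner_right v x]
    ring
  simp only [ricciOf, hterm, Finset.sum_add_distrib, Finset.sum_sub_distrib, ← Finset.mul_sum]
  rw [sum_inner_basis_mul e (hb.isLinearMap_right u), sum_inner_basis_mul' e (hb.isLinearMap_left v),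
    sum_inner_basis_mul e (hb.isLinearMap_right (J u)),
    sum_inner_basis_mul' e (hb.isLinearMap_left (J v)),
    sum_inner_basis_mul' e (hb.isLinearMap_right (J v)),
    sum_inner_basis_mul' e (hb.isLinearMap_right (J u)), hb.herm, hb.herm, hb.symm v u, tr]
  simp only [real_inner_self_eq_norm_sq, e.norm_eq_one]
  simp
  ring

end KahlerCurvature

/-! ### Kähler curvature tensors orthogonal to the `su(n)`-valued ones, and the projections. -/

section Components

variable {V : Type*} [NormedAddCommGroup V] [InnerProductSpace ℝ V] {n : ℕ}
  {J : V →L[ℝ] V} {R K L : V → V → V → V → ℝ} {b b' : V → V → ℝ}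
  (e : OrthonormalBasis (Fin (2 * n)) ℝ V)

theorem IsKahler.ricciStarOf_eq_ricciOf (hK : IsKahler J K) (u v : V) :
    ricciStarOf J e K u v = ricciOf e K u v :=
  Finset.sum_congr rfl fun _ _ ↦ hK.commute _ _ _ _

theorem IsKahler.isHermForm_ricciOf (hJ : IsOrthComplex J) (hK : IsKahler J K) :
    IsHermForm J (ricciOf e K) where
  toIsBilinearMap := hK.isBilinearMap_ricciOf e
  symm := hK.ricciOf_symm e
  herm u v := by
    rw [← hK.ricciStarOf_eq_ricciOf, hK.ricciStarOf_J e hJ, hK.ricciStarOf_eq_ricciOf,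
      hK.ricciOf_symm]

/-- The factor is `4 (1 + 3)`, because `Ric* = Ric` for a Kähler tensor. -/
theorem IsKahler.pair_kahlerOf (hJ : IsOrthComplex J) (hK : IsKahler J K) (hb : IsHermForm J b) :
    pair e K (kahlerOf J b) = 16 * ∑ i, ∑ j, ricciOf e K (e i) (e j) * b (e i) (e j) := by
  rw [SAH.pair_kahlerOf e hJ hK.toIsCurvature hb]
  simp only [hK.ricciStarOf_eq_ricciOf, Finset.mul_sum]
  exact Finset.sum_congr rfl fun _ _ ↦ Finset.sum_congr rfl fun _ _ ↦ by ring

/-- For a Kähler tensor `two_ricciStarOf` expresses the Ricci form through the complex trace.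
Together with `IsKahler.isCurSU` this shows that being `su(n)`-valued is the same as being
Ricci-flat. -/
theorem IsCurSU.ricciOf_eq_zero (hJ : IsOrthComplex J) (hK : IsCurSU J e K) (u v : V) :
    ricciOf e K u v = 0 := by
  have h := hK.two_ricciStarOf e hJ u v
  rw [hK.traceless, hK.ricciStarOf_eq_ricciOf] at h
  linarith

theorem IsKahler.isCurSU (hJ : IsOrthComplex J) (hK : IsKahler J K)
    (h : ∀ u v, ricciOf e K u v = 0) : IsCurSU J e K where
  toIsKahler := hK
  traceless u v := by
    -- The second argument is chosen so that applying `J` to it returns `v`.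
    have h1 := hK.two_ricciStarOf e hJ u (-J v)
    rw [hK.ricciStarOf_eq_ricciOf, h, map_neg, hJ.sq, neg_neg] at h1
    linarith

theorem IsCurSU.pair_kahlerOf (hJ : IsOrthComplex J) (hK : IsCurSU J e K) (hb : IsHermForm J b) :
    pair e K (kahlerOf J b) = 0 := by
  rw [hK.toIsKahler.pair_kahlerOf e hJ hb]
  simp [hK.ricciOf_eq_zero e hJ]

theorem IsKahler.add_smul (hK : IsKahler J K) (hL : IsKahler J L) (t : ℝ) :
    IsKahler J fun a b c d ↦ K a b c d + t * L a b c d where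
  toIsCurvature := hK.toIsCurvature.add_smul hL.toIsCurvature t
  commute a b c d := by rw [hK.commute, hL.commute]

theorem tr_inner : tr e (fun u v ↦ inner ℝ u v) = 2 * n := by
  simp [tr]

theorem tr_add_smul (s t : ℝ) : tr e (fun u v ↦ s * b u v + t * b' u v) =
    s * tr e b + t * tr e b' := by
  simp only [tr, Finset.sum_add_distrib, Finset.mul_sum]

theorem sum_inner_mul (hb : IsBilinearMap ℝ b) :
    ∑ i, ∑ j, inner ℝ (e i) (e j) * b (e i) (e j) = tr e b :=
  Finset.sum_congr rfl fun _ _ ↦ sum_inner_basis_mul' e (hb.isLinearMap_right _) _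

/-- A Kähler curvature tensor orthogonal to those with values in `su(n)` is determined by its
Ricci form. -/
theorem IsKahler.eq_kahlerOf (hJ : IsOrthComplex J) (hK : IsKahler J K)
    (hperp : ∀ L, IsCurSU J e L → pair e K L = 0) :
    K = kahlerOf J fun u v ↦ (2 * n + 4 : ℝ)⁻¹ * ricciOf e K u v +
      -(tr e (ricciOf e K) / (4 * n + 4) / (2 * n + 4)) * inner ℝ u v := by
  -- This `b` solves `tr b g + (2n+4) b = Ric`: taking traces gives `tr b = tr Ric / (4n+4)`.
  set b : V → V → ℝ := fun u v ↦ (2 * n + 4 : ℝ)⁻¹ * ricciOf e K u v +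
      -(tr e (ricciOf e K) / (4 * n + 4) / (2 * n + 4)) * inner ℝ u v with hbdef
  have hb : IsHermForm J b := (hK.isHermForm_ricciOf e hJ).add_smul (isHermForm_inner hJ) _ _
  have hn : (2 * n + 4 : ℝ) ≠ 0 := by positivity
  have hn' : (4 * n + 4 : ℝ) ≠ 0 := by positivity
  have hC : IsKahler J fun x y z w ↦ K x y z w + (-1) * kahlerOf J b x y z w :=
    hK.add_smul (isKahler_kahlerOf hJ hb) (-1)
  have hric : ∀ u v, ricciOf e (fun x y z w ↦ K x y z w + (-1) * kahlerOf J b x y z w) u v = 0 := by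
    intro u v
    have h1 : ricciOf e (fun x y z w ↦ K x y z w + (-1) * kahlerOf J b x y z w) u v =
        ricciOf e K u v - ricciOf e (kahlerOf J b) u v := by
      simp only [ricciOf, Finset.sum_add_distrib, ← Finset.mul_sum]; ring
    have htr : tr e b = (2 * n + 4 : ℝ)⁻¹ * tr e (ricciOf e K) +
        -(tr e (ricciOf e K) / (4 * n + 4) / (2 * n + 4)) * (2 * n) := by
      rw [hbdef, tr_add_smul, tr_inner]
    rw [h1, ricciOf_kahlerOf e hJ hb, htr, hbdef]
    field_simp
    ring
  have hSU := hC.isCurSU e hJ hric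
  -- The difference `K - Φ(b)` is Ricci-flat, hence `su(n)`-valued, hence orthogonal to both `K` and
  -- `Φ(b)` and so to itself. The pairing is a sum of squares.
  have h0 : pair e (fun x y z w ↦ K x y z w + (-1) * kahlerOf J b x y z w)
      (fun x y z w ↦ K x y z w + (-1) * kahlerOf J b x y z w) = 0 := by
    rw [pair_add_right, pair_smul_right, pair_comm, hperp _ hSU, hSU.pair_kahlerOf e hJ hb]
    ring
  have hzero : ∀ i j k l, K (e i) (e j) (e k) (e l) +
      (-1) * kahlerOf J b (e i) (e j) (e k) (e l) = 0 := by
    intro i j k l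
    rw [pair, Finset.sum_eq_zero_iff_of_nonneg fun _ _ ↦ by
      exact Finset.sum_nonneg fun _ _ ↦ Finset.sum_nonneg fun _ _ ↦
        Finset.sum_nonneg fun _ _ ↦ mul_self_nonneg _] at h0
    have h1 := h0 i (Finset.mem_univ _)
    rw [Finset.sum_eq_zero_iff_of_nonneg fun _ _ ↦ by
      exact Finset.sum_nonneg fun _ _ ↦ Finset.sum_nonneg fun _ _ ↦ mul_self_nonneg _] at h1
    have h2 := h1 j (Finset.mem_univ _)
    rw [Finset.sum_eq_zero_iff_of_nonneg fun _ _ ↦ by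
      exact Finset.sum_nonneg fun _ _ ↦ mul_self_nonneg _] at h2
    have h3 := h2 k (Finset.mem_univ _)
    rw [Finset.sum_eq_zero_iff_of_nonneg fun _ _ ↦ by exact mul_self_nonneg _] at h3
    exact mul_self_eq_zero.mp (h3 l (Finset.mem_univ _))
  funext x y z w
  have := hC.eq_zero_of_basis e hzero x y z w
  linarith

/-- The complex reflection along the complex line of `a`. -/
def complexReflection (J : V →L[ℝ] V) (a v : V) : V :=
  v - (2 / inner ℝ a a : ℝ) • ((inner ℝ a v : ℝ) • a + (inner ℝ (J a) v : ℝ) • J a)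

theorem complexReflection_J (hJ : IsOrthComplex J) (a v : V) :
    complexReflection J a (J v) = J (complexReflection J a v) := by
  simp only [complexReflection, map_sub, map_smul, map_add, hJ.sq, hJ.inner_map, hJ.inner_right a v]
  module

theorem inner_complexReflection (hJ : IsOrthComplex J) {a : V} (ha : a ≠ 0) (v w : V) :
    inner ℝ (complexReflection J a v) (complexReflection J a w) = inner ℝ v w := by
  have h0 : (inner ℝ a a : ℝ) ≠ 0 := by simpa using ha
  have h1 : inner ℝ (J a) a = 0 := by rw [real_inner_comm]; exact hJ.inner_self a
  simp only [complexReflection, inner_sub_left, inner_sub_right, inner_add_left, inner_add_right,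
    real_inner_smul_left, real_inner_smul_right, hJ.inner_self, h1, hJ.inner_map,
    real_inner_comm a v, real_inner_comm (J a) v]
  field_simp
  ring

theorem complexReflection_involutive (hJ : IsOrthComplex J) {a : V} (ha : a ≠ 0) (v : V) :
    complexReflection J a (complexReflection J a v) = v := by
  have h0 : (inner ℝ a a : ℝ) ≠ 0 := by simpa using ha
  have h1 : inner ℝ (J a) a = 0 := by rw [real_inner_comm]; exact hJ.inner_self a
  have h2 : ∀ p q r : V, v - p - (2 / inner ℝ a a : ℝ) •
      ((-inner ℝ a v : ℝ) • q + (-inner ℝ (J a) v : ℝ) • r) =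
      v - p + (2 / inner ℝ a a : ℝ) • ((inner ℝ a v : ℝ) • q + (inner ℝ (J a) v : ℝ) • r) :=
    fun _ _ _ ↦ by module
  have h3 : inner ℝ a (complexReflection J a v) = -inner ℝ a v := by
    simp only [complexReflection, inner_sub_right, inner_add_right, real_inner_smul_right,
      hJ.inner_self]
    field_simp; ring
  have h4 : inner ℝ (J a) (complexReflection J a v) = -inner ℝ (J a) v := by
    simp only [complexReflection, inner_sub_right, inner_add_right, real_inner_smul_right, h1,
      hJ.inner_map]
    field_simp; ring
  rw [complexReflection, h3, h4, complexReflection, h2, sub_add_cancel]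

/-- The complex reflection as an isometry. -/
def complexReflectionIsometry (hJ : IsOrthComplex J) {a : V} (ha : a ≠ 0) : V ≃ₗᵢ[ℝ] V where
  toFun := complexReflection J a
  invFun := complexReflection J a
  left_inv := complexReflection_involutive hJ ha
  right_inv := complexReflection_involutive hJ ha
  map_add' u v := by simp only [complexReflection, inner_add_right]; module
  map_smul' t v := by
    simp only [complexReflection, real_inner_smul_right, RingHom.id_apply]; module
  norm_map' v := by
    simp only [LinearEquiv.coe_mk, LinearMap.coe_mk, AddHom.coe_mk]
    rw [@norm_eq_sqrt_real_inner V, @norm_eq_sqrt_real_inner V, inner_complexReflection hJ ha]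

/-- Because `⟨u, Jv⟩ = 0`, the vector `u` has no component along `J (u - v)`. The complex reflection
therefore acts on `u` as the real reflection along `u - v`, which exchanges vectors of equal length.
-/
theorem complexReflection_sub (hJ : IsOrthComplex J) {u v : V} (h : u ≠ v)
    (huv : (inner ℝ u u : ℝ) = inner ℝ v v) (hJv : inner ℝ u (J v) = 0) :
    complexReflection J (u - v) u = v := by
  have h0 : (inner ℝ (u - v) (u - v) : ℝ) ≠ 0 := by simpa [sub_eq_zero] using h
  have h1 : (inner ℝ (J (u - v)) u : ℝ) = 0 := by
    rw [map_sub, inner_sub_left, real_inner_comm, hJ.inner_self, real_inner_comm, hJv, sub_zero]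
  have h2 : (inner ℝ (u - v) (u - v) : ℝ) = 2 * inner ℝ (u - v) u := by
    simp only [inner_sub_left, inner_sub_right, real_inner_comm u v, ← huv]; ring
  rw [complexReflection, h1, zero_smul, add_zero, smul_smul,
    show 2 / inner ℝ (u - v) (u - v) * inner ℝ (u - v) u = (1 : ℝ) by
      rw [h2] at h0 ⊢; rw [div_mul_eq_mul_div, div_self h0], one_smul, sub_sub_cancel]

/-- A `U(n)`-invariant Hermitian form is a multiple of the metric. -/
theorem IsHermForm.eq_smul_inner (hJ : IsOrthComplex J) (hb : IsHermForm J b)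
    (hinv : ∀ g : V ≃ₗᵢ[ℝ] V, (∀ v, g (J v) = J (g v)) → ∀ u v, b (g u) (g v) = b u v) :
    ∃ t : ℝ, ∀ u v, b u v = t * inner ℝ u v := by
  have swap : ∀ u v : V, (inner ℝ u u : ℝ) = inner ℝ v v → inner ℝ u (J v) = 0 →
      b u u = b v v := by
    intro u v huv hJv
    by_cases h : u = v
    · rw [h]
    · have hs := complexReflection_sub hJ h huv hJv
      have hi := hinv (complexReflectionIsometry hJ (sub_ne_zero.mpr h))
        (complexReflection_J hJ _) u u
      change b (complexReflection J (u - v) u) (complexReflection J (u - v) u) = b u u at hi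
      rw [hs] at hi
      exact hi.symm
  have hbJ : ∀ x, b x (J x) = 0 := fun x ↦ by
    have h1 := hb.apply_J_left hJ x x
    rw [hb.symm] at h1
    linarith
  have hsm : ∀ (s : ℝ) (u : V), b (s • u) (s • u) = s * s * b u u := fun s u ↦ by
    rw [hb.smul_left, hb.smul_right]; simp only [smul_eq_mul]; ring
  have hunit : ∀ u v : V, inner ℝ u u = (1 : ℝ) → inner ℝ v v = (1 : ℝ) → b u u = b v v := by
    intro u v hu hv
    set p : ℝ := inner ℝ u v with hp
    set q : ℝ := inner ℝ u (J v) with hq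
    by_cases hq0 : q = 0
    · exact swap u v (hu.trans hv.symm) hq0
    · have hr : 0 < p ^ 2 + q ^ 2 := by positivity
      set r := Real.sqrt (p ^ 2 + q ^ 2) with hrdef
      have hr2 : r * r = p ^ 2 + q ^ 2 := Real.mul_self_sqrt hr.le
      have hJv0 : inner ℝ v (J v) = (0 : ℝ) := hJ.inner_self v
      have hJv1 : inner ℝ (J v) v = (0 : ℝ) := by rw [real_inner_comm]; exact hJv0
      -- The vector `p v + q J v` is the projection of `u` to the complex line of `v`. It has length
      -- `r`, and `⟨u, J(p v + q J v)⟩ = 0`, so the previous case applies; as `b(v, Jv) = 0`, its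
      -- value under `b` is `r² b(v, v)`.
      have h := swap (r • u) (p • v + q • J v) ?_ ?_
      · rw [hsm, hr2, hb.add_left, hb.add_right, hb.add_right, hsm, hsm, hb.herm] at h
        simp only [hb.smul_left, hb.smul_right, hbJ, hb.symm (J v) v, smul_eq_mul] at h
        have : (p ^ 2 + q ^ 2) * (b u u - b v v) = 0 := by linear_combination h
        rcases mul_eq_zero.mp this with h' | h'
        · exact absurd h' hr.ne'
        · linarith
      · simp only [inner_add_left, inner_add_right, real_inner_smul_left, real_inner_smul_right,
          hJ.inner_map, hu, hv, hJv0, hJv1]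
        linear_combination hr2
      · simp only [map_add, map_smul, hJ.sq, inner_add_right, real_inner_smul_left,
          real_inner_smul_right, smul_neg, inner_neg_right, ← hp, ← hq]
        ring
  by_cases hV : ∃ v : V, v ≠ 0
  · obtain ⟨v, hv⟩ := hV
    have hnv : ∀ v : V, v ≠ 0 → inner ℝ (‖v‖⁻¹ • v) (‖v‖⁻¹ • v) = (1 : ℝ) := fun v hv ↦ by
      have := norm_ne_zero_iff.mpr hv
      rw [real_inner_smul_left, real_inner_smul_right, real_inner_self_eq_norm_sq]
      field_simp
    set t := b (‖v‖⁻¹ • v) (‖v‖⁻¹ • v)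
    have hdiag : ∀ u, b u u = t * inner ℝ u u := fun u ↦ by
      by_cases hu : u = 0
      · rw [hu, (hb.isLinearMap_right _).map_zero, inner_zero_left, mul_zero]
      · have h1 := hunit _ _ (hnv u hu) (hnv v hv)
        have := norm_ne_zero_iff.mpr hu
        rw [hsm] at h1
        rw [real_inner_self_eq_norm_sq]
        change _ = t at h1
        rw [← h1]
        field_simp
    refine ⟨t, fun u w ↦ ?_⟩
    have h1 := hdiag (u + w)
    rw [hb.add_left, hb.add_right, hb.add_right, hb.symm w u, inner_add_left, inner_add_right,
      inner_add_right, real_inner_comm u w, hdiag u, hdiag w] at h1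
    linarith
  · push Not at hV
    exact ⟨0, fun u v ↦ by rw [hV u, (hb.isLinearMap_left _).map_zero, zero_mul]⟩

theorem kahlerOf_map (g : V ≃ₗᵢ[ℝ] V) (hg : ∀ v, g (J v) = J (g v))
    (x y z w : V) :
    kahlerOf J (fun u v ↦ inner ℝ u v) (g x) (g y) (g z) (g w) =
      kahlerOf J (fun u v ↦ inner ℝ u v) x y z w := by
  simp only [kahlerOf, ← hg, LinearIsometryEquiv.inner_map_map]

theorem isK1_kahlerOf_inner (hJ : IsOrthComplex J) (t : ℝ) :
    IsK1 J e fun a b c d ↦ t * kahlerOf J (fun u v ↦ inner ℝ u v) a b c d := by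
  have hg := isHermForm_inner hJ
  refine ⟨?_, fun L hL ↦ ?_, fun g hgJ a b c d ↦ ?_⟩
  · have h := isKahler_kahlerOf hJ (hg.add_smul hg t 0)
    convert h using 5
    rw [kahlerOf_add_smul]; ring
  · rw [pair_comm, pair_smul_right, hL.pair_kahlerOf e hJ hg, mul_zero]
  · simp only [kahlerOf_map g hgJ]

/-- Traces are basis-independent, so invariance of `K` passes to its Ricci form, which is then a
multiple of the metric; the Ricci form determines `K`. -/
theorem IsK1.exists_eq (hJ : IsOrthComplex J) (hK : IsK1 J e K) :
    ∃ t : ℝ, K = fun a b c d ↦ t * kahlerOf J (fun u v ↦ inner ℝ u v) a b c d := by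
  obtain ⟨t, ht⟩ := (hK.isHermForm_ricciOf e hJ).eq_smul_inner hJ fun g hg u v ↦ by
    have h : ∀ i, K (g u) (e i) (g v) (e i) = K u (g.symm (e i)) v (g.symm (e i)) := fun i ↦ by
      rw [← hK.invariant g hg u, g.apply_symm_apply]
    simp only [ricciOf, h]
    exact sum_basis_eq (f := fun a c ↦ K u a v c)
      (isBilinearMap_of (fun _ ↦ hK.lin₂ _ _ _) (fun _ ↦ hK.lin₄ _ _ _)) (e.map g.symm) e
  rw [hK.toIsKahler.eq_kahlerOf e hJ hK.perp_su]
  simp only [ht]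
  refine ⟨(2 * n + 4 : ℝ)⁻¹ * t +
    -(tr e (ricciOf e K) / (4 * n + 4) / (2 * n + 4)), ?_⟩
  have hr : ricciOf e K = fun u v ↦ t * inner ℝ u v := by funext u v; exact ht u v
  rw [hr]
  funext x y z w
  simp only [kahlerOf]
  ring

theorem pair_kahlerOf_kahlerOf (hJ : IsOrthComplex J) (hb : IsHermForm J b)
    (hb' : IsHermForm J b') : pair e (kahlerOf J b) (kahlerOf J b') =
      16 * (tr e b * tr e b' + (2 * n + 4) * ∑ i, ∑ j, b (e i) (e j) * b' (e i) (e j)) := by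
  rw [(isKahler_kahlerOf hJ hb).pair_kahlerOf e hJ hb', ← sum_inner_mul e hb'.toIsBilinearMap]
  simp only [ricciOf_kahlerOf e hJ hb, add_mul, Finset.sum_add_distrib, Finset.mul_sum, mul_assoc]

/-- The form is the one determined by the Ricci form of `K`. Its trace vanishes because the pairing
of `Φ(b)` with `Φ(g) ∈ 𝒦₁` is `16 (4n + 4) tr b`. -/
theorem IsK2.exists_eq (hn : n ≠ 0) (hJ : IsOrthComplex J) (hK : IsK2 J e K) :
    ∃ b, IsHermForm J b ∧ tr e b = 0 ∧ K = kahlerOf J b := by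
  refine ⟨_, (hK.isHermForm_ricciOf e hJ).add_smul (isHermForm_inner hJ) _ _, ?_,
    hK.toIsKahler.eq_kahlerOf e hJ hK.perp_su⟩
  set b : V → V → ℝ := fun u v ↦ (2 * n + 4 : ℝ)⁻¹ * ricciOf e K u v +
      -(tr e (ricciOf e K) / (4 * n + 4) / (2 * n + 4)) * inner ℝ u v with hbdef
  have hb : IsHermForm J b := (hK.isHermForm_ricciOf e hJ).add_smul (isHermForm_inner hJ) _ _
  have h := hK.perp_K1 _ (isK1_kahlerOf_inner e hJ 1)
  rw [pair_smul_right, hK.toIsKahler.eq_kahlerOf e hJ hK.perp_su, ← hbdef, pair_comm,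
    pair_kahlerOf_kahlerOf e hJ (isHermForm_inner hJ) hb, tr_inner,
    sum_inner_mul e hb.toIsBilinearMap] at h
  have hpos : (0 : ℝ) < 16 * (2 * n + (2 * n + 4)) := by positivity
  have : 16 * (2 * n + (2 * n + 4)) * tr e b = 0 := by linear_combination h
  exact (mul_eq_zero.mp this).resolve_left hpos.ne'

theorem IsHermForm.isK2_kahlerOf (hJ : IsOrthComplex J) (hb : IsHermForm J b)
    (htr : tr e b = 0) : IsK2 J e (kahlerOf J b) where
  toIsKahler := isKahler_kahlerOf hJ hb
  perp_su L hL := by rw [pair_comm, hL.pair_kahlerOf e hJ hb]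
  perp_K1 L hL := by
    obtain ⟨t, rfl⟩ := hL.exists_eq e hJ
    rw [pair_smul_right, pair_comm, pair_kahlerOf_kahlerOf e hJ (isHermForm_inner hJ) hb, htr,
      sum_inner_mul e hb.toIsBilinearMap, htr]
    ring

/-- The Hermitian part of `3 Ric* + Ric`. -/
theorem isHermForm_hermPart (hJ : IsOrthComplex J) (hR : IsCurvature R) :
    IsHermForm J fun u v ↦ 3 * hermPart J (ricciStarOf J e R) u v +
      hermPart J (ricciOf e R) u v where
  add_left u u' v := by
    simp only [hermPart, map_add, (hR.isBilinearMap_ricciOf e).add_left,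
      (hR.isBilinearMap_ricciStarOf e).add_left]
    ring
  smul_left t u v := by
    simp only [hermPart, map_smul, (hR.isBilinearMap_ricciOf e).smul_left,
      (hR.isBilinearMap_ricciStarOf e).smul_left, smul_eq_mul]
    ring
  add_right u u' v := by
    simp only [hermPart, map_add, (hR.isBilinearMap_ricciOf e).add_right,
      (hR.isBilinearMap_ricciStarOf e).add_right]
    ring
  smul_right t u v := by
    simp only [hermPart, map_smul, (hR.isBilinearMap_ricciOf e).smul_right,
      (hR.isBilinearMap_ricciStarOf e).smul_right, smul_eq_mul]
    ring
  symm u v := by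
    simp only [hermPart, hR.ricciStarOf_J e hJ, hR.ricciOf_symm e u v,
      hR.ricciOf_symm e (J u) (J v)]
    ring
  herm u v := by
    simp only [hermPart, hR.ricciStarOf_J e hJ u v, hJ.sq,
      ((hR.isBilinearMap_ricciOf e).isLinearMap_left _).map_neg,
      ((hR.isBilinearMap_ricciOf e).isLinearMap_right _).map_neg,
      ((hR.isBilinearMap_ricciStarOf e).isLinearMap_left _).map_neg,
      ((hR.isBilinearMap_ricciStarOf e).isLinearMap_right _).map_neg]
    ring

/-- Since `b` is `J`-invariant, its pairing with a form `f` equals its pairing with `f(J·, J·)`, so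
only Hermitian parts contribute. -/
theorem pair_kahlerOf_hermPart (hJ : IsOrthComplex J) (hR : IsCurvature R)
    (hb : IsHermForm J b) : pair e R (kahlerOf J b) =
      4 * ∑ i, ∑ j, (3 * hermPart J (ricciStarOf J e R) (e i) (e j) +
        hermPart J (ricciOf e R) (e i) (e j)) * b (e i) (e j) := by
  have hJJ : ∀ f : V → V → ℝ, IsBilinearMap ℝ f →
      ∑ i, ∑ j, f (J (e i)) (J (e j)) * b (e i) (e j) =
        ∑ i, ∑ j, f (e i) (e j) * b (e i) (e j) := by
    intro f hf
    have h1 : ∀ u, ∑ j, f (J u) (J (e j)) * b u (e j) = ∑ j, f (J u) (e j) * b (J u) (e j) := by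
      intro u
      rw [← hJ.sum_basis e (f := fun x y ↦ f (J u) x * b (J u) y)]
      · simp only [hb.herm]
      · exact isBilinearMap_of (fun _ ↦ isLinearMap_mul_const (hf.isLinearMap_right _) _)
          (fun _ ↦ isLinearMap_const_mul (hb.isLinearMap_right _) _)
    simp only [h1]
    exact hJ.sum_basis e (f := fun x y ↦ ∑ j, f x (e j) * b y (e j))
      (isBilinearMap_of
        (fun _ ↦ isLinearMap_sum fun _ ↦ isLinearMap_mul_const (hf.isLinearMap_left _) _)
        (fun _ ↦ isLinearMap_sum fun _ ↦ isLinearMap_const_mul (hb.isLinearMap_left _) _))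
  have h1 := hJJ _ (hR.isBilinearMap_ricciOf e)
  have h2 := hJJ _ (hR.isBilinearMap_ricciStarOf (J := J) e)
  have hsum : ∑ i, ∑ j, (3 * hermPart J (ricciStarOf J e R) (e i) (e j) +
        hermPart J (ricciOf e R) (e i) (e j)) * b (e i) (e j) =
      3 / 2 * ∑ i, ∑ j, ricciStarOf J e R (e i) (e j) * b (e i) (e j) +
      3 / 2 * ∑ i, ∑ j, ricciStarOf J e R (J (e i)) (J (e j)) * b (e i) (e j) +
      1 / 2 * ∑ i, ∑ j, ricciOf e R (e i) (e j) * b (e i) (e j) +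
      1 / 2 * ∑ i, ∑ j, ricciOf e R (J (e i)) (J (e j)) * b (e i) (e j) := by
    simp only [Finset.mul_sum, ← Finset.sum_add_distrib, hermPart]
    exact Finset.sum_congr rfl fun _ _ ↦ Finset.sum_congr rfl fun _ _ ↦ by ring
  rw [hsum, h1, h2, pair_kahlerOf e hJ hR hb]
  simp only [add_mul, mul_assoc, Finset.sum_add_distrib, ← Finset.mul_sum]
  ring

variable {T : V → V → ℝ}

/-- The coefficient is the quotient of `⟨R, Φ(g)⟩ = 4 tr T` by `⟨Φ(g), Φ(g)⟩ = 128 n (n+1)`. -/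
theorem isComponent_K1 (hn : n ≠ 0) (hJ : IsOrthComplex J) (hR : IsCurvature R)
    (hT : ∀ u v, 3 * hermPart J (ricciStarOf J e R) u v + hermPart J (ricciOf e R) u v = T u v) :
    IsComponent e (IsK1 J e) R fun a b c d ↦ tr e T / (32 * n * (n + 1)) *
      kahlerOf J (fun u v ↦ inner ℝ u v) a b c d := by
  have hTb : IsHermForm J T := by simpa only [hT] using isHermForm_hermPart e hJ hR
  refine ⟨isK1_kahlerOf_inner e hJ _, fun B hB ↦ ?_⟩
  obtain ⟨t, rfl⟩ := hB.exists_eq e hJ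
  have hg := isHermForm_inner hJ
  have h1 : ∑ i, ∑ j, T (e i) (e j) * inner ℝ (e i) (e j) = tr e T := by
    rw [← sum_inner_mul e hTb.toIsBilinearMap]; simp only [mul_comm]
  rw [pair_sub_smul, pair_smul_right, pair_smul_right, pair_kahlerOf_hermPart e hJ hR hg,
    pair_kahlerOf_kahlerOf e hJ hg hg, sum_inner_mul e hg.toIsBilinearMap, tr_inner]
  simp only [hT, h1]
  have : (n : ℝ) ≠ 0 := by exact_mod_cast hn
  have : (n + 1 : ℝ) ≠ 0 := by positivity
  field_simp
  ring

/-- For trace-free `b` one has `⟨R, Φ(b)⟩ = 4⟨T, b⟩`, while pairing `Φ(b)` with `Φ` of the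
trace-free part of `T` gives `32 (n+2) ⟨T, b⟩`. -/
theorem isComponent_K2 (hn : n ≠ 0) (hJ : IsOrthComplex J) (hR : IsCurvature R)
    (hT : ∀ u v, 3 * hermPart J (ricciStarOf J e R) u v + hermPart J (ricciOf e R) u v = T u v) :
    IsComponent e (IsK2 J e) R fun a b c d ↦ 1 / (8 * (n + 2)) *
      kahlerOf J (fun u v ↦ T u v - tr e T / (2 * n) * inner ℝ u v) a b c d := by
  have hn' : (n : ℝ) ≠ 0 := by exact_mod_cast hn
  have hTb : IsHermForm J T := by simpa only [hT] using isHermForm_hermPart e hJ hR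
  have hg := isHermForm_inner hJ
  have hT0 : IsHermForm J fun u v ↦ T u v - tr e T / (2 * n) * inner ℝ u v := by
    simpa [sub_eq_add_neg] using hTb.add_smul hg 1 (-(tr e T / (2 * n)))
  have htr : tr e (fun u v ↦ T u v - tr e T / (2 * n) * inner ℝ u v) = 0 := by
    have h1 : tr e (fun u v ↦ T u v - tr e T / (2 * n) * inner ℝ u v) = tr e T -
        tr e T / (2 * n) * tr e (fun u v ↦ inner ℝ u v) := by
      simp only [tr, Finset.sum_sub_distrib, ← Finset.mul_sum]
    rw [h1, tr_inner]; field_simp; ring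
  refine ⟨?_, fun B hB ↦ ?_⟩
  · have h := (hT0.add_smul hg (1 / (8 * (n + 2))) 0).isK2_kahlerOf e hJ
      (by rw [tr_add_smul, htr]; ring)
    convert h using 5
    rw [kahlerOf_add_smul]; ring
  · obtain ⟨b, hb, hb0, rfl⟩ := hB.exists_eq e hn hJ
    have hsum : ∑ i, ∑ j, (T (e i) (e j) - tr e T / (2 * n) * inner ℝ (e i) (e j)) *
        b (e i) (e j) = ∑ i, ∑ j, T (e i) (e j) * b (e i) (e j) := by
      simp only [sub_mul, Finset.sum_sub_distrib, mul_assoc, ← Finset.mul_sum]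
      rw [sum_inner_mul e hb.toIsBilinearMap, hb0]; ring
    rw [pair_sub_smul, pair_kahlerOf_hermPart e hJ hR hb, pair_kahlerOf_kahlerOf e hJ hT0 hb, hb0,
      hsum]
    simp only [hT]
    field_simp
    ring

end Components

/-! ### Linear algebra of `su(n)` and the pointwise curvature identity. -/

section Pointwise

variable {V : Type*} [NormedAddCommGroup V] [InnerProductSpace ℝ V] {n : ℕ}
  {J : V →L[ℝ] V}

/-- For skew `B` the trace of `B²` is `-∑ |B eᵢ|²`. -/
theorem trace_mul_self_eq_zero [FiniteDimensional ℝ V] {B : V →ₗ[ℝ] V}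
    (hB : ∀ v w, inner ℝ (B v) w = -inner ℝ v (B w))
    (h : LinearMap.trace ℝ V (B * B) = 0) : B = 0 := by
  let e := stdOrthonormalBasis ℝ V
  rw [LinearMap.trace_eq_sum_inner _ e] at h
  have h1 : ∀ i, inner ℝ (e i) ((B * B) (e i)) = -inner ℝ (B (e i)) (B (e i)) := fun i ↦ by
    rw [hB, neg_neg]; rfl
  simp only [h1, Finset.sum_neg_distrib, neg_eq_zero] at h
  rw [Finset.sum_eq_zero_iff_of_nonneg fun _ _ ↦ real_inner_self_nonneg] at h
  refine e.toBasis.ext fun i ↦ ?_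
  have := h i (Finset.mem_univ i)
  rw [inner_self_eq_zero] at this
  simpa using this

/-- The `J`-linear part of a skew-symmetric endomorphism orthogonal to `su(n)` is a multiple
of `J`. -/
theorem linearPart_eq_of_perp_su [FiniteDimensional ℝ V] (hn : n ≠ 0)
    (hdim : Module.finrank ℝ V = 2 * n) (hJ : IsOrthComplex J) {A : V →L[ℝ] V}
    (hA : ∀ v w, inner ℝ (A v) w = -inner ℝ v (A w))
    (hperp : ∀ B : V →L[ℝ] V, (∀ v w, inner ℝ (B v) w = -inner ℝ v (B w)) →
      (∀ v, B (J v) = J (B v)) →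
      LinearMap.trace ℝ V ((J ∘L B : _ →L[ℝ] _) : _ →ₗ[ℝ] _) = 0 →
      LinearMap.trace ℝ V ((A ∘L B : _ →L[ℝ] _) : _ →ₗ[ℝ] _) = 0) (v : V) :
    A v - J (A (J v)) = (2 * (-(1 / (2 * n : ℝ)) *
      LinearMap.trace ℝ V ((A ∘L J : _ →L[ℝ] _) : _ →ₗ[ℝ] _))) • J v := by
  -- The constant makes `tr (J B) = 0`, so that `B`, the `J`-linear part of `A` minus `c J`, lies in
  -- `su(n)`. It remains to see that `B = 0`.
  set c : ℝ := -(1 / (2 * n : ℝ)) *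
      LinearMap.trace ℝ V ((A ∘L J : _ →L[ℝ] _) : _ →ₗ[ℝ] _) with hc
  set B : V →L[ℝ] V := (1 / 2 : ℝ) • (A - J ∘L A ∘L J) - c • J with hBdef
  have hBv : ∀ v, B v = (1 / 2 : ℝ) • (A v - J (A (J v))) - c • J v := fun _ ↦ rfl
  have hBskew : ∀ v w, inner ℝ (B v) w = -inner ℝ v (B w) := fun v w ↦ by
    have h1 : inner ℝ (J (A (J v))) w = -inner ℝ v (J (A (J w))) := by
      rw [hJ.inner_right, neg_neg, ← neg_neg (inner ℝ (J (A (J v))) w), ← hJ.inner_right, hA,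
        neg_neg]
    have h2 : inner ℝ (J v) w = -inner ℝ v (J w) := by rw [hJ.inner_right, neg_neg]
    simp only [hBv, inner_sub_left, inner_sub_right, real_inner_smul_left, real_inner_smul_right,
      h1, h2, hA]
    ring
  have hBJ : ∀ v, B (J v) = J (B v) := fun v ↦ by
    simp only [hBv, map_sub, map_smul, hJ.sq, map_neg]
    module
  let a : Module.End ℝ V := A
  let j : Module.End ℝ V := J
  let b : Module.End ℝ V := B
  have hjj : j * j = -1 := LinearMap.ext fun v ↦ hJ.sq v
  have hb : b = (1 / 2 : ℝ) • (a - j * a * j) - c • j := rfl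
  have hbj : b * j = j * b := LinearMap.ext fun v ↦ hBJ v
  have htr1 : LinearMap.trace ℝ V (1 : Module.End ℝ V) = 2 * n := by
    rw [LinearMap.trace_one, hdim]; push_cast; rfl
  have hn' : (n : ℝ) ≠ 0 := by exact_mod_cast hn
  have htrJ : LinearMap.trace ℝ V (j * b) = 0 := by
    have h1 : j * b = (1 / 2 : ℝ) • (j * a + a * j) + c • 1 := by
      rw [hb, mul_sub, mul_smul_comm, mul_sub, mul_smul_comm, hjj, ← mul_assoc, ← mul_assoc, hjj]
      simp
    rw [h1, map_add, map_smul, map_smul, map_add, LinearMap.trace_mul_comm ℝ j a, htr1, hc]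
    change (1 / 2 : ℝ) • (_ + _) + (-(1 / (2 * n : ℝ)) * LinearMap.trace ℝ V (a * j)) • _ = (0 : ℝ)
    simp only [smul_eq_mul]
    field_simp
    ring
  have htrA : LinearMap.trace ℝ V (a * b) = 0 := hperp B hBskew hBJ htrJ
  -- As `B` commutes with `J`, `tr (J A J B) = -tr (A B)`. Hence `tr (B²) = tr (A B) - c tr (J B)`,
  -- and both terms vanish.
  have htrBB : LinearMap.trace ℝ V (b * b) = 0 := by
    have h1 : LinearMap.trace ℝ V (j * a * j * b) = -LinearMap.trace ℝ V (a * b) := by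
      rw [mul_assoc, ← hbj, ← mul_assoc, LinearMap.trace_mul_comm, ← mul_assoc, ← mul_assoc, hjj]
      simp
    have h2 : b * b = (1 / 2 : ℝ) • (a * b - j * a * j * b) - c • (j * b) := by
      nth_rewrite 1 [hb]
      rw [sub_mul, smul_mul_assoc, sub_mul, smul_mul_assoc]
    rw [h2, map_sub, map_smul, map_smul, map_sub, h1, htrA, htrJ]
    simp
  have hB0 := trace_mul_self_eq_zero (B := b) hBskew htrBB
  have : B v = 0 := congrArg (fun f : Module.End ℝ V ↦ f v) hB0
  rw [hBv, sub_eq_zero] at this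
  rw [mul_smul, ← this, smul_smul]
  norm_num

/-- `u` is a unitary frame. -/
def IsUnitaryFrame (J : V →L[ℝ] V) {ι : Type*} (u : ι → V) : Prop :=
  Orthonormal ℝ u ∧ ∀ i j, inner ℝ (u i) (J (u j)) = 0

theorem IsUnitaryFrame.orthonormal_sum {k : ℕ} {u : Fin k → V} (hJ : IsOrthComplex J)
    (hu : IsUnitaryFrame J u) : Orthonormal ℝ (Sum.elim u fun i ↦ J (u i)) := by
  have h := orthonormal_iff_ite.mp hu.1
  rw [orthonormal_iff_ite]
  rintro (i | i) (j | j)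
  · simpa using h i j
  · simpa using hu.2 i j
  · simpa [real_inner_comm] using hu.2 j i
  · simpa [hJ.inner_map] using h i j

/-- Induction on the size `k` of the frame: `u` and `J u` span at most `2k < 2n` real dimensions,
and any unit vector orthogonal to this span enlarges the frame. -/
theorem exists_isUnitaryFrame [FiniteDimensional ℝ V] (hJ : IsOrthComplex J)
    (hdim : Module.finrank ℝ V = 2 * n) : ∃ u : Fin n → V, IsUnitaryFrame J u := by
  suffices h : ∀ k ≤ n, ∃ u : Fin k → V, IsUnitaryFrame J u from h n le_rfl
  intro k
  induction k with
  | zero => exact fun _ ↦ ⟨Fin.elim0, ⟨fun i ↦ i.elim0, fun i ↦ i.elim0⟩, fun i ↦ i.elim0⟩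
  | succ k ih =>
    intro hk
    obtain ⟨u, hu⟩ := ih (by omega)
    let W := Submodule.span ℝ (Set.range (Sum.elim u fun i ↦ J (u i)))
    have hW : Module.finrank ℝ W ≤ 2 * k := by
      refine (finrank_range_le_card _).trans ?_
      simp; omega
    have hWne : Wᗮ ≠ ⊥ := fun h ↦ by
      have h1 := W.finrank_add_finrank_orthogonal
      rw [h, finrank_bot, hdim] at h1
      omega
    obtain ⟨w, hw, hw0⟩ := Submodule.exists_mem_ne_zero_of_ne_bot hWne
    have hw1 : ∀ i, inner ℝ (u i) w = (0 : ℝ) := fun i ↦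
      hw _ (Submodule.subset_span ⟨Sum.inl i, rfl⟩)
    have hw2 : ∀ i, inner ℝ (J (u i)) w = (0 : ℝ) := fun i ↦
      hw _ (Submodule.subset_span ⟨Sum.inr i, rfl⟩)
    have hnw : ‖w‖ ≠ 0 := norm_ne_zero_iff.mpr hw0
    have h := orthonormal_iff_ite.mp hu.1
    refine ⟨Fin.cons (‖w‖⁻¹ • w) u, orthonormal_iff_ite.mpr fun i j ↦ ?_, fun i j ↦ ?_⟩
    · refine Fin.cases ?_ (fun i ↦ ?_) i <;> refine Fin.cases ?_ (fun j ↦ ?_) j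
      · rw [if_pos rfl]
        simp only [Fin.cons_zero, real_inner_smul_left, real_inner_smul_right]
        rw [real_inner_self_eq_norm_sq]
        field_simp
      · simp [real_inner_smul_left, real_inner_comm _ w, hw1, (Fin.succ_ne_zero _).symm]
      · simp [real_inner_smul_right, hw1]
      · simpa using h i j
    · refine Fin.cases ?_ (fun i ↦ ?_) i <;> refine Fin.cases ?_ (fun j ↦ ?_) j
      · simp [real_inner_smul_left, real_inner_smul_right, hJ.inner_self]
      · simp [real_inner_smul_left, real_inner_comm _ w, hw2]
      · simp [real_inner_smul_right, hJ.inner_right, hw2]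
      · simpa using hu.2 i j

/-- An endomorphism of `u(n)` that annihilates a complex volume form is complex traceless. -/
theorem sum_inner_J_eq_zero [FiniteDimensional ℝ V] (hJ : IsOrthComplex J)
    (hdim : Module.finrank ℝ V = 2 * n) {Ψ : V [⋀^Fin n]→ₗ[ℝ] ℂ}
    (hΨJ : ∀ (v : Fin n → V) (i : Fin n),
      Ψ (Function.update v i (J (v i))) = Complex.I * Ψ v)
    (hΨ1 : ∀ u : Fin n → V, IsUnitaryFrame J u → Ψ u ≠ 0)
    {B : V → V} (hBlin : IsLinearMap ℝ B) (hB : ∀ v, inner ℝ (B v) v = (0 : ℝ))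
    (hBJ : ∀ v, B (J v) = J (B v))
    (hBΨ : ∀ u : Fin n → V, ∑ i, Ψ (Function.update u i (B (u i))) = 0)
    {ι : Type*} [Fintype ι] (e : OrthonormalBasis ι ℝ V) :
    ∑ i, inner ℝ (B (e i)) (J (e i)) = (0 : ℝ) := by
  obtain ⟨u, hu⟩ := exists_isUnitaryFrame hJ hdim
  have hso := hu.orthonormal_sum hJ
  obtain ⟨f, hf⟩ := Orthonormal.exists_orthonormalBasis_extension_of_card_eq
    (ι := Fin n ⊕ Fin n) (v := Sum.elim u fun i ↦ J (u i)) (s := Set.univ)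
    (by simp [hdim]; omega) (hso.comp _ Subtype.val_injective)
  have hf1 : ∀ i, f (Sum.inl i) = u i := fun i ↦ hf _ (Set.mem_univ _)
  have hf2 : ∀ i, f (Sum.inr i) = J (u i) := fun i ↦ hf _ (Set.mem_univ _)
  -- Expand `B (u i)` in the real basis `u, J u`. The components along `u j`, `J (u j)` with `j ≠ i`
  -- repeat an argument of `Ψ`, the one along `u i` vanishes by skewness, and the one along `J (u
  -- i)` produces the factor `i`.
  have hterm : ∀ i, Ψ (Function.update u i (B (u i))) =
      (inner ℝ (B (u i)) (J (u i)) : ℝ) * (Complex.I * Ψ u) := by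
    intro i
    have hexp := f.sum_repr' (B (u i))
    rw [Fintype.sum_sum_type] at hexp
    simp only [hf1, hf2] at hexp
    have h1 : ∀ j, j ≠ i → Ψ (Function.update u i (u j)) = 0 := fun j hj ↦
      Ψ.map_update_self u (Ne.symm hj)
    have h2 : ∀ j, Ψ (Function.update u i (J (u j))) =
        Complex.I * Ψ (Function.update u i (u j)) := fun j ↦ by
      have := hΨJ (Function.update u i (u j)) i
      simpa using this
    rw [← hexp, Ψ.map_update_add, Ψ.map_update_sum, Ψ.map_update_sum]
    simp only [Ψ.map_update_smul, h2]
    rw [Finset.sum_eq_single i (fun j _ hj ↦ by rw [h1 j hj, smul_zero]) (by simp),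
      Finset.sum_eq_single i (fun j _ hj ↦ by rw [h1 j hj, mul_zero, smul_zero]) (by simp),
      real_inner_comm, hB, hexp, Function.update_eq_self, real_inner_comm (B (u i))]
    simp
  have hsum : ∑ i, inner ℝ (B (u i)) (J (u i)) = (0 : ℝ) := by
    have h := hBΨ u
    simp only [hterm] at h
    rw [← Finset.sum_mul, mul_eq_zero] at h
    rcases h with h | h
    · exact_mod_cast h
    · exact absurd (mul_eq_zero.mp h) (by simp [hΨ1 u hu])
  rw [sum_basis_eq (f := fun x y ↦ inner ℝ (B x) (J y)) _ e f, Fintype.sum_sum_type]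
  · simp only [hf1, hf2, hBJ, hJ.inner_map]
    rw [hsum, zero_add, ← hsum]
  · refine isBilinearMap_of (fun v ↦ ⟨fun x y ↦ ?_, fun t x ↦ ?_⟩)
      (fun v ↦ ⟨fun x y ↦ ?_, fun t x ↦ ?_⟩)
    · rw [hBlin.map_add, inner_add_left]
    · rw [hBlin.map_smul, real_inner_smul_left, smul_eq_mul]
    · rw [map_add, inner_add_right]
    · rw [map_smul, real_inner_smul_right, smul_eq_mul]

/-- Replacing `eᵢ` by `J eᵢ` leaves the trace unchanged but reverses its sign. -/
theorem sum_inner_J_eq_zero_of_antilinear (hJ : IsOrthComplex J) {ι : Type*} [Fintype ι]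
    (e : OrthonormalBasis ι ℝ V) {B : V → V} (hBlin : IsLinearMap ℝ B)
    (hBJ : ∀ v, B (J v) = -J (B v)) : ∑ i, inner ℝ (B (e i)) (J (e i)) = (0 : ℝ) := by
  have h := hJ.sum_basis e (f := fun x y ↦ inner ℝ (B x) (J y))
    (isBilinearMap_of
      (fun v ↦ ⟨fun x y ↦ by rw [hBlin.map_add, inner_add_left],
        fun t x ↦ by rw [hBlin.map_smul, real_inner_smul_left, smul_eq_mul]⟩)
      (fun v ↦ ⟨fun x y ↦ by rw [map_add, inner_add_right],
        fun t x ↦ by rw [map_smul, real_inner_smul_right, smul_eq_mul]⟩))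
  simp only [hBJ, inner_neg_left, hJ.inner_map, Finset.sum_neg_distrib] at h
  linarith

/-- The algebraic consequence of the decomposition of the curvature along the minimal
connection: `3 Ric*_H + Ric_H` in terms of the torsion. -/
theorem three_ricciStar_add_ricci (hJ : IsOrthComplex J)
    (e : OrthonormalBasis (Fin (2 * n)) ℝ V) {R : V → V → V → V → ℝ} (hR : IsCurvature R)
    {P N : V → V → V → V} {ξ : V → V → V} {dη : V → V → ℝ}
    (hPJ : ∀ u v w, P u v (J w) = J (P u v w))
    (hP : ∀ u v, ∑ i, inner ℝ (P u v (e i)) (J (e i)) = (0 : ℝ))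
    (hN : ∀ u v, IsLinearMap ℝ (N u v)) (hNJ : ∀ u v w, N u v (J w) = -J (N u v w))
    (hξ : ∀ u, IsLinearMap ℝ (ξ u)) (hξJ : ∀ u v, ξ u (J v) = -J (ξ u v))
    (hξskew : ∀ u v w, inner ℝ (ξ u v) w = (-inner ℝ v (ξ u w) : ℝ))
    (hdec : ∀ u v w z, R u v w z = inner ℝ (P u v w + dη u v • J w + (N u v w - N v u w
      + ξ (ξ u v) w - ξ (ξ v u) w) - (ξ u (ξ v w) - ξ v (ξ u w))) z) (X Y : V) :
    3 * hermPart J (ricciStarOf J e R) X Y + hermPart J (ricciOf e R) X Y =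
      2 * n * dη X (J Y) - 2 * n * dη (J X) Y
      + ∑ i, (
        - inner ℝ (N (e i) X Y) (e i) + inner ℝ (N X (e i) Y) (e i)
        - inner ℝ (N (e i) (J X) (J Y)) (e i) + inner ℝ (N (J X) (e i) (J Y)) (e i)
        - inner ℝ (ξ (ξ (e i) X) Y) (e i) + inner ℝ (ξ (ξ X (e i)) Y) (e i)
        - inner ℝ (ξ (ξ (e i) (J X)) (J Y)) (e i) + inner ℝ (ξ (ξ (J X) (e i)) (J Y)) (e i)
        - 2 * inner ℝ (ξ X (e i)) (ξ (J Y) (J (e i)))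
        - 2 * inner ℝ (ξ Y (e i)) (ξ (J X) (J (e i)))) := by
  -- The terms `P`, `dη J` and `[ξ, ξ]` commute with `J` and cancel; `N` and `ξ_ξ` anticommute with
  -- `J` and double.
  have hdiff : ∀ u v w z, R u v w z - R u v (J w) (J z) =
      2 * (inner ℝ (N u v w) z - inner ℝ (N v u w) z
        + inner ℝ (ξ (ξ u v) w) z - inner ℝ (ξ (ξ v u) w) z) := by
    intro u v w z
    have h1 : ∀ a b, ξ a (ξ b (J w)) = J (ξ a (ξ b w)) := fun a b ↦ by
      rw [hξJ, (hξ a).map_neg, hξJ, neg_neg]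
    rw [hdec, hdec]
    simp only [hPJ, hNJ, hξJ, (hξ _).map_neg, neg_neg, inner_add_left, inner_sub_left,
      inner_neg_left, real_inner_smul_left, hJ.inner_map]
    ring
  have hric : ∀ u v, ricciOf e R u v - ricciStarOf J e R u v =
      2 * ∑ i, (inner ℝ (N u (e i) v) (e i) - inner ℝ (N (e i) u v) (e i)
        + inner ℝ (ξ (ξ u (e i)) v) (e i) - inner ℝ (ξ (ξ (e i) u) v) (e i)) := fun u v ↦ by
    rw [ricciOf, ricciStarOf, ← Finset.sum_sub_distrib, Finset.mul_sum]
    exact Finset.sum_congr rfl fun i _ ↦ hdiff _ _ _ _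
  have hanti : ∀ u v, ∑ i, inner ℝ (ξ u (e i)) (ξ v (J (e i))) =
      -∑ i, inner ℝ (ξ v (e i)) (ξ u (J (e i))) := fun u v ↦ by
    rw [← hJ.sum_basis e (f := fun x y ↦ inner ℝ (ξ v x) (ξ u (J y))), ← Finset.sum_neg_distrib]
    · refine Finset.sum_congr rfl fun i _ ↦ ?_
      rw [hJ.sq, (hξ u).map_neg, inner_neg_right, neg_neg, real_inner_comm]
    · refine isBilinearMap_of (fun v ↦ ⟨fun x y ↦ ?_, fun t x ↦ ?_⟩)
        (fun v ↦ ⟨fun x y ↦ ?_, fun t x ↦ ?_⟩)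
      · rw [(hξ _).map_add, inner_add_left]
      · rw [(hξ _).map_smul, real_inner_smul_left, smul_eq_mul]
      · rw [map_add, (hξ _).map_add, inner_add_right]
      · rw [map_smul, (hξ _).map_smul, real_inner_smul_right, smul_eq_mul]
  -- Here the terms anticommuting with `J` drop out, `P` is traceless, `J` contributes `2n`, and
  -- skewness of `ξ` makes the two halves of the commutator equal.
  have htrace : ∀ u v, ∑ i, R u v (e i) (J (e i)) =
      2 * n * dη u v - 2 * ∑ i, inner ℝ (ξ u (e i)) (ξ v (J (e i))) := by
    intro u v
    have hξ2 : ∀ a b, ∑ i, inner ℝ (ξ (ξ a b) (e i)) (J (e i)) = (0 : ℝ) := fun a b ↦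
      sum_inner_J_eq_zero_of_antilinear hJ e (hξ _) (hξJ _)
    have hN2 : ∀ a b, ∑ i, inner ℝ (N a b (e i)) (J (e i)) = (0 : ℝ) := fun a b ↦
      sum_inner_J_eq_zero_of_antilinear hJ e (hN _ _) (hNJ _ _)
    have h1 : ∀ i, R u v (e i) (J (e i)) = inner ℝ (P u v (e i)) (J (e i)) + dη u v
        + inner ℝ (N u v (e i)) (J (e i)) - inner ℝ (N v u (e i)) (J (e i))
        + inner ℝ (ξ (ξ u v) (e i)) (J (e i)) - inner ℝ (ξ (ξ v u) (e i)) (J (e i))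
        + inner ℝ (ξ v (e i)) (ξ u (J (e i))) - inner ℝ (ξ u (e i)) (ξ v (J (e i))) := fun i ↦ by
      rw [hdec]
      simp only [inner_add_left, inner_sub_left, real_inner_smul_left, hJ.inner_map,
        real_inner_self_eq_norm_sq, e.norm_eq_one, hξskew u (ξ v (e i)), hξskew v (ξ u (e i))]
      ring
    simp only [h1, Finset.sum_add_distrib, Finset.sum_sub_distrib, hP, hN2, hξ2, hanti v u]
    simp
    ring
  have h1 := hR.two_ricciStarOf e hJ X Y
  have h2 := hR.two_ricciStarOf e hJ (J X) (J Y)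
  simp only [hJ.sq, hR.neg₂, Finset.sum_neg_distrib] at h2
  rw [htrace] at h1 h2
  rw [hanti (J X) Y] at h2
  have h3 := hric X Y
  have h4 := hric (J X) (J Y)
  simp only [Finset.sum_add_distrib, Finset.sum_sub_distrib, Finset.sum_neg_distrib,
    ← Finset.mul_sum] at h3 h4 ⊢
  simp only [hermPart]
  -- `h1 + h2` computes `4 Ric*_H`, and `(h3 + h4) / 2` computes `(Ric - Ric*)_H`.
  linear_combination h1 + h2 + h3 / 2 + h4 / 2

end Pointwise

/-! ### Germs of smooth vector fields, tensoriality and the commutator of derivations. -/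

section SmoothFields

set_option linter.unusedSectionVars false

open Filter Topology

variable {E : Type*} [NormedAddCommGroup E] [NormedSpace ℝ E] [FiniteDimensional ℝ E]
  {H : Type*} [TopologicalSpace H] {I : ModelWithCorners ℝ E H}
  {M : Type*} [TopologicalSpace M] [ChartedSpace H M] [IsManifold I ∞ M]

/-- A vector field that is smooth at every point of a neighbourhood of `x`. -/
def SmoothNear (X : Π x : M, TangentSpace I x) (x : M) : Prop :=
  ∀ᶠ y in 𝓝 x, CMDiffAt ∞ (T% X) y

variable (I) in
/-- A function that is smooth at every point of a neighbourhood of `x`. -/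
def SmoothFunNear (f : M → ℝ) (x : M) : Prop :=
  ∀ᶠ y in 𝓝 x, ContMDiffAt I 𝓘(ℝ, ℝ) ∞ f y

variable {X Y Z W : Π x : M, TangentSpace I x} {f g : M → ℝ} {x : M}

namespace SmoothFunNear

theorem eventually (hf : SmoothFunNear I f x) : ∀ᶠ y in 𝓝 x, SmoothFunNear I f y :=
  eventually_eventually_nhds.mpr hf

theorem contMDiffAt (hf : SmoothFunNear I f x) : ContMDiffAt I 𝓘(ℝ, ℝ) ∞ f x := hf.self_of_nhds

theorem mdiffAt (hf : SmoothFunNear I f x) : MDiffAt f x :=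
  hf.contMDiffAt.mdifferentiableAt (by simp)

theorem congr (hf : SmoothFunNear I f x) (h : f =ᶠ[𝓝 x] g) : SmoothFunNear I g x := by
  filter_upwards [hf, h.eventuallyEq_nhds] with y hy hy'
  exact hy.congr_of_eventuallyEq hy'.symm

theorem const (c : ℝ) : SmoothFunNear I (fun _ : M ↦ c) x :=
  Eventually.of_forall fun _ ↦ contMDiffAt_const

theorem div (hf : SmoothFunNear I f x) (hg : SmoothFunNear I g x) (h : g x ≠ 0) :
    SmoothFunNear I (fun y ↦ f y / g y) x := by
  filter_upwards [hf, hg, hg.contMDiffAt.continuousAt.eventually_ne h] with y h1 h2 h3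
  exact h1.div₀ h2 h3

end SmoothFunNear

namespace SmoothNear

theorem eventually (hX : SmoothNear X x) : ∀ᶠ y in 𝓝 x, SmoothNear X y :=
  eventually_eventually_nhds.mpr hX

theorem contMDiffAt (hX : SmoothNear X x) : CMDiffAt ∞ (T% X) x := hX.self_of_nhds

theorem mdiffAt (hX : SmoothNear X x) : MDiffAt (T% X) x :=
  hX.contMDiffAt.mdifferentiableAt (by simp)

theorem congr (hX : SmoothNear X x) (h : ∀ᶠ y in 𝓝 x, X y = Y y) : SmoothNear Y x := by
  filter_upwards [hX, eventually_eventually_nhds.mpr h] with y hy hy'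
  refine hy.congr_of_eventuallyEq ?_
  filter_upwards [hy'] with z hz
  rw [hz]

theorem ext (v : TangentSpace I x) : SmoothNear (SAH.ext v) x := by
  obtain ⟨s, hs, h⟩ := FiberBundle.exists_contMDiffOn_extend (k := ∞) I E v
  filter_upwards [eventually_mem_nhds_iff.mpr hs] with y hy
  exact h.contMDiffAt hy

theorem add (hX : SmoothNear X x) (hY : SmoothNear Y x) :
    SmoothNear (fun y ↦ X y + Y y) x := by
  filter_upwards [hX, hY] with y h1 h2 using h1.add_section h2

theorem sub (hX : SmoothNear X x) (hY : SmoothNear Y x) :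
    SmoothNear (fun y ↦ X y - Y y) x := by
  filter_upwards [hX, hY] with y h1 h2 using h1.sub_section h2

theorem neg (hX : SmoothNear X x) : SmoothNear (fun y ↦ -X y) x := by
  filter_upwards [hX] with y h1 using h1.neg_section

theorem smul (hf : SmoothFunNear I f x) (hX : SmoothNear X x) :
    SmoothNear (fun y ↦ f y • X y) x := by
  filter_upwards [hf, hX] with y h1 h2 using h1.smul_section h2

theorem const_smul (c : ℝ) (hX : SmoothNear X x) : SmoothNear (fun y ↦ c • X y) x :=
  smul (SmoothFunNear.const c) hX

theorem sum {ι : Type*} {s : Finset ι} {X : ι → Π x : M, TangentSpace I x}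
    (hX : ∀ i ∈ s, SmoothNear (X i) x) : SmoothNear (fun y ↦ ∑ i ∈ s, X i y) x := by
  filter_upwards [(eventually_all_finset s).mpr hX] with y h
  exact ContMDiffAt.sum_section h

theorem connection {D : Connection I M} (hD : IsSmooth D) (hX : SmoothNear X x)
    (hY : SmoothNear Y x) : SmoothNear (fun y ↦ D Y y (X y)) x := by
  filter_upwards [hX, hY] with y h1 h2 using hD X Y y h1 h2

theorem mlieBracket (hX : SmoothNear X x) (hY : SmoothNear Y x) :
    SmoothNear (mlieBracket I X Y) x := by
  have : IsManifold I ((⊤ : ℕ∞) + 1) M := inferInstanceAs (IsManifold I ∞ M)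
  have : IsManifold I (minSmoothness ℝ 2) M := by
    rw [minSmoothness_of_isRCLikeNormedField]; infer_instance
  filter_upwards [hX, hY] with y h1 h2
  exact ContMDiffAt.mlieBracket_vectorField (m := ⊤) (n := ⊤) h1 h2 (by simp)

end SmoothNear

theorem ext_self (v : TangentSpace I x) : SAH.ext v x = v := FiberBundle.extend_apply_self E v

/-- An operation on vector fields that is linear over germs at `x` of smooth functions. -/
structure IsSmoothTensorial {A : Type*} [AddCommGroup A] [Module ℝ A]
    (Φ : (Π x : M, TangentSpace I x) → A) (x : M) : Prop where
  smul : ∀ {f : M → ℝ} {X : Π x : M, TangentSpace I x}, SmoothFunNear I f x → SmoothNear X x →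
    Φ (fun y ↦ f y • X y) = f x • Φ X
  add : ∀ {X Y : Π x : M, TangentSpace I x}, SmoothNear X x → SmoothNear Y x →
    Φ (fun y ↦ X y + Y y) = Φ X + Φ Y

namespace IsSmoothTensorial

variable {A : Type*} [AddCommGroup A] [Module ℝ A] {Φ : (Π x : M, TangentSpace I x) → A}

/-- Multiply both fields by the indicator `ψ` of the set where they agree. The products coincide
everywhere, and `ψ` is constantly `1` near `x`; smoothness is only required there, so no cut-off
function is needed. -/
theorem congr (hΦ : IsSmoothTensorial Φ x) (hX : SmoothNear X x) (hY : SmoothNear Y x)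
    (h : ∀ᶠ y in 𝓝 x, X y = Y y) : Φ X = Φ Y := by
  classical
  let ψ : M → ℝ := fun y ↦ if X y = Y y then 1 else 0
  have hψx : ψ x = 1 := by simp [ψ, h.self_of_nhds]
  have heq : (fun y ↦ ψ y • X y) = fun y ↦ ψ y • Y y := by
    funext y
    dsimp [ψ]
    split_ifs with hy <;> simp [hy]
  have hψ : SmoothFunNear I ψ x := (SmoothFunNear.const 1).congr <| by
    filter_upwards [h] with y hy
    simp [ψ, hy]
  calc Φ X = Φ (fun y ↦ ψ y • X y) := by rw [hΦ.smul hψ hX, hψx, one_smul]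
    _ = Φ Y := by rw [heq, hΦ.smul hψ hY, hψx, one_smul]

theorem zero (hΦ : IsSmoothTensorial Φ x) : Φ (fun _ ↦ 0) = 0 := by
  have h := hΦ.smul (SmoothFunNear.const 0) (SmoothNear.ext (0 : TangentSpace I x))
  simpa using h

theorem sum (hΦ : IsSmoothTensorial Φ x) {ι : Type*} {s : Finset ι}
    {X : ι → Π x : M, TangentSpace I x} (hX : ∀ i ∈ s, SmoothNear (X i) x) :
    Φ (fun y ↦ ∑ i ∈ s, X i y) = ∑ i ∈ s, Φ (X i) := by
  classical
  induction s using Finset.induction_on with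
  | empty => simpa using hΦ.zero
  | insert a s ha ih =>
    simp only [Finset.mem_insert, forall_eq_or_imp] at hX
    simp only [Finset.sum_insert ha, ← ih hX.2]
    exact hΦ.add hX.1 (SmoothNear.sum hX.2)

/-- A smooth tensorial operation depends only on the value of the vector field at `x`. -/
theorem pointwise (hΦ : IsSmoothTensorial Φ x) (hX : SmoothNear X x) (hY : SmoothNear Y x)
    (h : X x = Y x) : Φ X = Φ Y := by
  let t := trivializationAt E (TangentSpace I : M → Type _) x
  have hx : x ∈ t.baseSet := FiberBundle.mem_baseSet_trivializationAt E (TangentSpace I) x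
  have hev : ∀ᶠ y in 𝓝 x, y ∈ t.baseSet := t.open_baseSet.mem_nhds hx
  let b := Module.Basis.ofVectorSpace ℝ E
  let s := t.localFrame b
  let c := t.localFrameCoeff I b
  have hs : ∀ i, SmoothNear (s i) x := fun i ↦ by
    filter_upwards [hev] with y hy using contMDiffAt_localFrame_of_mem ∞ _ b i hy
  have hc : ∀ {Z : Π x : M, TangentSpace I x}, SmoothNear Z x →
      ∀ i, SmoothFunNear I (fun y ↦ c i y (Z y)) x := fun hZ i ↦ by
    filter_upwards [hZ, hev] with y h1 h2 using contMDiffAt_localFrameCoeff b h2 h1 i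
  -- Expansion in a local frame shows that `Φ Z` depends only on the coefficients of `Z` at `x`.
  have hexp : ∀ {Z : Π x : M, TangentSpace I x}, SmoothNear Z x →
      Φ Z = ∑ i, c i x (Z x) • Φ (s i) := fun {Z} hZ ↦ by
    have hsm : ∀ i ∈ Finset.univ, SmoothNear (fun y ↦ c i y (Z y) • s i y) x :=
      fun i _ ↦ SmoothNear.smul (hc hZ i) (hs i)
    rw [hΦ.congr hZ (SmoothNear.sum hsm) (t.eventually_eq_localFrame_sum_coeff_smul b hx),
      hΦ.sum hsm]
    exact Finset.sum_congr rfl fun i _ ↦ hΦ.smul (hc hZ i) (hs i)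
  rw [hexp hX, hexp hY, h]

theorem isLinearMap_ext (hΦ : IsSmoothTensorial Φ x) :
    IsLinearMap ℝ fun v : TangentSpace I x ↦ Φ (SAH.ext v) where
  map_add v w := by
    rw [← hΦ.add (SmoothNear.ext v) (SmoothNear.ext w)]
    exact hΦ.pointwise (SmoothNear.ext _) ((SmoothNear.ext v).add (SmoothNear.ext w))
      (by simp only [ext_self])
  map_smul c v := by
    refine Eq.trans ?_ (hΦ.smul (f := fun _ ↦ c) (SmoothFunNear.const c) (SmoothNear.ext v))
    exact hΦ.pointwise (SmoothNear.ext _) ((SmoothNear.ext v).const_smul c)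
      (by simp only [ext_self])

end IsSmoothTensorial

section Connections

variable (D : Connection I M)

theorem connection_add (hX : SmoothNear X x) (hY : SmoothNear Y x) (u : TangentSpace I x) :
    D (fun y ↦ X y + Y y) x u = D X x u + D Y x u :=
  congr($(D.isCovariantDerivativeOn.add hX.mdiffAt hY.mdiffAt (Set.mem_univ x)) u)

theorem connection_smul (hf : SmoothFunNear I f x) (hX : SmoothNear X x) (u : TangentSpace I x) :
    D (fun y ↦ f y • X y) x u = f x • D X x u + d% f x u • X x :=
  congr($(D.isCovariantDerivativeOn.leibniz hX.mdiffAt hf.mdiffAt (Set.mem_univ x)) u)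

theorem connection_congr (hX : SmoothNear X x) (h : ∀ᶠ y in 𝓝 x, X y = Y y)
    (u : TangentSpace I x) : D X x u = D Y x u :=
  congr($(D.isCovariantDerivativeOn.congr_of_eventuallyEq (s := Set.univ) hX.mdiffAt
    (hX.congr h).mdiffAt univ_mem h) u)

theorem connection_const_smul (c : ℝ) (hX : SmoothNear X x) (u : TangentSpace I x) :
    D (fun y ↦ c • X y) x u = c • D X x u :=
  congr($(D.isCovariantDerivativeOn.smul_const c hX.mdiffAt (Set.mem_univ x)) u)

theorem connection_neg (hX : SmoothNear X x) (u : TangentSpace I x) :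
    D (fun y ↦ -X y) x u = -D X x u := by
  have h := connection_const_smul D (-1) hX u
  simpa using h

theorem connection_sub (hX : SmoothNear X x) (hY : SmoothNear Y x) (u : TangentSpace I x) :
    D (fun y ↦ X y - Y y) x u = D X x u - D Y x u := by
  simp only [sub_eq_add_neg]
  rw [connection_add D hX hY.neg, connection_neg D hY]

end Connections

section Derivatives

theorem mvfderiv_congr {F : Type*} [NormedAddCommGroup F] [NormedSpace ℝ F] {f g : M → F}
    (h : f =ᶠ[𝓝 x] g) : mvfderiv I f x = mvfderiv I g x := by
  have h' := h.mfderiv_eq (I := I) (I' := 𝓘(ℝ, F))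
  simp only [mvfderiv]
  ext v
  simp only [ContinuousLinearMap.comp_apply]
  rw [h']
  rfl

variable [RiemannianBundle (fun x : M ↦ TangentSpace I x)]
  [IsContMDiffRiemannianBundle I ∞ E (fun x : M ↦ TangentSpace I x)]

theorem SmoothNear.inner (hX : SmoothNear X x) (hY : SmoothNear Y x) :
    SmoothFunNear I (fun y ↦ inner ℝ (X y) (Y y)) x := by
  filter_upwards [hX, hY] with y h1 h2 using
    ContMDiffAt.inner_bundle (F := E) (E := fun x : M ↦ TangentSpace I x) (b := fun y ↦ y) h1 h2

theorem mlieBracket_fun_smul (hf : SmoothFunNear I f x) (hY : SmoothNear Y x) :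
    mlieBracket I X (fun y ↦ f y • Y y) x = d% f x (X x) • Y x + f x • mlieBracket I X Y x :=
  mlieBracket_smul_right hf.mdiffAt hY.mdiffAt

theorem exists_ext_ne_zero [Nontrivial E] (x : M) : ∃ w : TangentSpace I x, w ≠ 0 :=
  (exists_ne (0 : E) : ∃ w : E, w ≠ 0)

/-- Smoothness of `X f` is read off from that of brackets: `(X f) W = [X, f W] - f [X, W]`, paired
with a field `W` that does not vanish near `x`. -/
theorem SmoothFunNear.deriv [Nontrivial E] (hf : SmoothFunNear I f x) (hX : SmoothNear X x) :
    SmoothFunNear I (fun y ↦ d% f y (X y)) x := by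
  obtain ⟨w, hw⟩ := exists_ext_ne_zero (I := I) x
  set W : Π x : M, TangentSpace I x := SAH.ext w
  have hW : SmoothNear W x := SmoothNear.ext w
  have hfW := SmoothNear.smul hf hW
  have h1 : SmoothNear (fun y ↦ d% f y (X y) • W y) x := by
    refine ((hX.mlieBracket hfW).sub (SmoothNear.smul hf (hX.mlieBracket hW))).congr ?_
    filter_upwards [hf.eventually, hW.eventually] with y h1 h2
    rw [mlieBracket_fun_smul h1 h2, add_sub_cancel_right]
  have hne : (inner ℝ (W x) (W x) : ℝ) ≠ 0 := by
    rw [show W x = w from ext_self w]; simpa using hw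
  refine ((h1.inner hW).div (hW.inner hW) hne).congr ?_
  filter_upwards [(hW.inner hW).contMDiffAt.continuousAt.eventually_ne hne] with y hy
  rw [real_inner_smul_left, mul_div_assoc, div_self hy, mul_one]

/-- The commutator of vector fields acting on functions is their Lie bracket. -/
theorem deriv_deriv_sub [Nontrivial E] (hf : SmoothFunNear I f x) (hX : SmoothNear X x)
    (hY : SmoothNear Y x) :
    d% (fun y ↦ d% f y (Y y)) x (X x) - d% (fun y ↦ d% f y (X y)) x (Y x) =
      d% f x (mlieBracket I X Y x) := by
  obtain ⟨w, hw⟩ := exists_ext_ne_zero (I := I) x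
  set W : Π x : M, TangentSpace I x := SAH.ext w
  have hW : SmoothNear W x := SmoothNear.ext w
  have hfW := SmoothNear.smul hf hW
  have : IsManifold I (minSmoothness ℝ 3) M := by
    simp only [minSmoothness_of_isRCLikeNormedField]
    infer_instance
  have hle : ∀ {Z : Π x : M, TangentSpace I x}, SmoothNear Z x →
      CMDiffAt (minSmoothness ℝ 2) (T% Z) x := fun hZ ↦ by
    simp only [minSmoothness_of_isRCLikeNormedField]
    exact hZ.contMDiffAt.of_le ENat.LEInfty.out
  -- The Jacobi identity for `X, Y, f W`, reduced by `f` times the one for `X, Y, W`, leaves the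
  -- required identity as the coefficient of `W`.
  have J1 := leibniz_identity_mlieBracket_apply (hle hX) (hle hY) (hle hfW)
  have J0 := leibniz_identity_mlieBracket_apply (hle hX) (hle hY) (hle hW)
  have hbr : ∀ {Z Z' : Π x : M, TangentSpace I x}, SmoothNear Z x → SmoothNear Z' x →
      mlieBracket I Z (mlieBracket I Z' fun y ↦ f y • W y) x =
      (d% (fun y ↦ d% f y (Z' y)) x (Z x)) • W x + d% f x (Z' x) • mlieBracket I Z W x
        + (d% f x (Z x) • mlieBracket I Z' W x + f x • mlieBracket I Z (mlieBracket I Z' W) x) := by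
    intro Z Z' hZ hZ'
    have heq : mlieBracket I Z (mlieBracket I Z' fun y ↦ f y • W y) x =
        mlieBracket I Z (fun y ↦ d% f y (Z' y) • W y + f y • mlieBracket I Z' W y) x := by
      refine Filter.EventuallyEq.mlieBracket_vectorField_eq EventuallyEq.rfl ?_
      filter_upwards [hf.eventually, hW.eventually] with y h1 h2
      exact mlieBracket_fun_smul h1 h2
    have hdf := hf.deriv hZ'
    have hZW := hZ'.mlieBracket hW
    have hadd := mlieBracket_add_right (V := Z) (SmoothNear.smul hdf hW).mdiffAt
      (SmoothNear.smul hf hZW).mdiffAt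
    rw [heq]
    refine hadd.trans ?_
    rw [mlieBracket_fun_smul hdf hW, mlieBracket_fun_smul hf hZW]
  rw [hbr hX hY, hbr hY hX, mlieBracket_fun_smul hf hW, J0] at J1
  have h : (d% (fun y ↦ d% f y (Y y)) x (X x) - d% (fun y ↦ d% f y (X y)) x (Y x) -
      d% f x (mlieBracket I X Y x)) • W x = 0 := by
    linear_combination (norm := module) J1
  rw [show W x = w from ext_self w] at h
  exact sub_eq_zero.mp ((smul_eq_zero.mp h).resolve_right hw)

end Derivatives

end SmoothFields

/-- A quadrilinear form that is skew in both pairs and satisfies the Bianchi identity is symmetric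
under exchange of the pairs. -/
theorem pair_symm_of_bianchi {V : Type*} {K : V → V → V → V → ℝ}
    (h₁ : ∀ a b c d, K b a c d = -K a b c d) (h₂ : ∀ a b c d, K a b d c = -K a b c d)
    (h₃ : ∀ a b c d, K a b c d + K b c a d + K c a b d = 0) (a b c d : V) :
    K c d a b = K a b c d := by
  -- The four Bianchi identities obtained by rotating `a, b, c, d` are combined; skewness matches
  -- their terms.
  linarith [h₃ a b c d, h₃ b c d a, h₃ c d a b, h₃ d a b c, h₂ b c a d, h₂ c d a b, h₁ b d c a,
    h₁ a d c b, h₂ a d b c, h₁ c a d b, h₂ c a b d, h₁ a d b c, h₂ a b c d, h₂ b d c a]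

/-! ### Symmetries of the Riemann tensor. -/

section Curvature

open Filter Topology

set_option linter.unusedSectionVars false

variable {E : Type*} [NormedAddCommGroup E] [NormedSpace ℝ E] [FiniteDimensional ℝ E]
  {H : Type*} [TopologicalSpace H] {I : ModelWithCorners ℝ E H}
  {M : Type*} [TopologicalSpace M] [ChartedSpace H M] [IsManifold I ∞ M]
  [RiemannianBundle (fun x : M ↦ TangentSpace I x)]
  [IsContMDiffRiemannianBundle I ∞ E (fun x : M ↦ TangentSpace I x)]
  {D : Connection I M} {X Y Z W : Π x : M, TangentSpace I x} {f g : M → ℝ} {x : M}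

theorem connection_connection_smul [Nontrivial E] (hD : IsSmooth D) (hf : SmoothFunNear I f x)
    (hY : SmoothNear Y x) (hZ : SmoothNear Z x) (u : TangentSpace I x) :
    D (fun y ↦ D (fun y ↦ f y • Z y) y (Y y)) x u =
      f x • D (fun y ↦ D Z y (Y y)) x u + d% f x u • D Z x (Y x)
        + (d% f x (Y x) • D Z x u + d% (fun y ↦ d% f y (Y y)) x u • Z x) := by
  have hDZ := SmoothNear.connection hD hY hZ
  rw [connection_congr D (SmoothNear.connection hD hY (SmoothNear.smul hf hZ))
    (Y := fun y ↦ f y • D Z y (Y y) + d% f y (Y y) • Z y)]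
  · rw [connection_add D (SmoothNear.smul hf hDZ) (SmoothNear.smul (hf.deriv hY) hZ),
      connection_smul D hf hDZ, connection_smul D (hf.deriv hY) hZ]
  · filter_upwards [hf.eventually, hZ.eventually] with y h1 h2
    exact connection_smul D h1 h2 _

/-- First derivatives of `f` cancel between the two orders of differentiation, and second
derivatives cancel against `[X, Y] f`. -/
theorem curvatureOp_tensorial₃ [Nontrivial E] (hD : IsSmooth D) (hX : SmoothNear X x)
    (hY : SmoothNear Y x) : IsSmoothTensorial (fun Z ↦ curvatureOp D X Y Z x) x where
  smul {f Z} hf hZ := by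
    have h := deriv_deriv_sub hf hX hY
    simp only [curvatureOp]
    rw [connection_connection_smul hD hf hY hZ, connection_connection_smul hD hf hX hZ,
      connection_smul D hf hZ, ← h]
    module
  add {Z Z'} hZ hZ' := by
    have h : ∀ {Y : Π x : M, TangentSpace I x}, SmoothNear Y x → ∀ u,
        D (fun y ↦ D (fun y ↦ Z y + Z' y) y (Y y)) x u =
          D (fun y ↦ D Z y (Y y)) x u + D (fun y ↦ D Z' y (Y y)) x u := fun hY u ↦ by
      rw [← connection_add D (SmoothNear.connection hD hY hZ) (SmoothNear.connection hD hY hZ')]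
      refine connection_congr D (SmoothNear.connection hD hY (hZ.add hZ')) ?_ u
      filter_upwards [hZ.eventually, hZ'.eventually] with y h1 h2
      exact connection_add D h1 h2 _
    simp only [curvatureOp]
    rw [h hX, h hY, connection_add D hZ hZ']
    abel

theorem curvatureOp_tensorial₁ (hD : IsSmooth D) (hZ : SmoothNear Z x) :
    IsSmoothTensorial (fun X ↦ curvatureOp D X Y Z x) x where
  smul {f X} hf hX := by
    have h1 : mlieBracket I (fun y ↦ f y • X y) Y x =
        -(d% f x (Y x) • X x) + f x • mlieBracket I X Y x :=
      (mlieBracket_smul_left hf.mdiffAt hX.mdiffAt).trans (by rw [neg_smul])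
    simp only [curvatureOp, map_smul]
    rw [connection_smul D hf (SmoothNear.connection hD hX hZ), h1, map_add, map_neg, map_smul,
      map_smul]
    module
  add {X X'} hX hX' := by
    have h1 : mlieBracket I (fun y ↦ X y + X' y) Y x = mlieBracket I X Y x + mlieBracket I X' Y x :=
      mlieBracket_add_left hX.mdiffAt hX'.mdiffAt
    simp only [curvatureOp, map_add]
    rw [connection_add D (SmoothNear.connection hD hX hZ) (SmoothNear.connection hD hX' hZ), h1,
      map_add]
    abel

theorem curvatureOp_swap : curvatureOp D Y X Z x = -curvatureOp D X Y Z x := by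
  simp only [curvatureOp]
  rw [mlieBracket_swap_apply, map_neg]
  abel

/-- Apply the commutator formula to the function `|Z|²`; the terms `⟨∇_X Z, ∇_Y Z⟩` are symmetric in
`X, Y` and cancel. -/
theorem inner_curvatureOp_self [Nontrivial E] (hD : IsSmooth D) (hm : IsMetric D)
    (hX : SmoothNear X x) (hY : SmoothNear Y x) (hZ : SmoothNear Z x) :
    inner ℝ (curvatureOp D X Y Z x) (Z x) = (0 : ℝ) := by
  have key : ∀ {X Y : Π x : M, TangentSpace I x}, SmoothNear X x → SmoothNear Y x →
      d% (fun y ↦ d% (fun y ↦ (inner ℝ (Z y) (Z y) : ℝ)) y (Y y)) x (X x) =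
        2 * (inner ℝ (D (fun y ↦ D Z y (Y y)) x (X x)) (Z x) +
          inner ℝ (D Z x (Y x)) (D Z x (X x))) := by
    intro X Y hX hY
    have hDZ := SmoothNear.connection hD hY hZ
    have h1 : (fun y ↦ d% (fun y ↦ (inner ℝ (Z y) (Z y) : ℝ)) y (Y y)) =ᶠ[𝓝 x]
        fun y ↦ inner ℝ ((2 : ℝ) • D Z y (Y y)) (Z y) := by
      filter_upwards [hZ] with y h
      rw [hm Z Z y (Y y) h h, real_inner_comm (D Z y (Y y)), real_inner_smul_left]
      ring
    rw [mvfderiv_congr h1, hm _ Z x (X x) (hDZ.const_smul 2).contMDiffAt hZ.contMDiffAt,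
      connection_const_smul D 2 hDZ, real_inner_smul_left, real_inner_smul_left]
    ring
  have h := deriv_deriv_sub (hZ.inner hZ) hX hY
  rw [key hX hY, key hY hX, hm Z Z x _ hZ.contMDiffAt hZ.contMDiffAt] at h
  simp only [curvatureOp, inner_add_left, inner_sub_left]
  rw [real_inner_comm (D Z x (X x)) (D Z x (Y x)),
    real_inner_comm (D Z x (mlieBracket I X Y x)) (Z x)] at h
  linarith

theorem torsion_free_apply (hD : IsLeviCivita D) (hX : SmoothNear X x) (hY : SmoothNear Y x) :
    D Y x (X x) - D X x (Y x) = mlieBracket I X Y x :=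
  (CovariantDerivative.torsion_eq_zero_iff D).mp hD.torsion_free hX.mdiffAt hY.mdiffAt

/-- Vanishing torsion turns the cyclic sum into double brackets, which vanish by the Jacobi
identity. -/
theorem curvatureOp_bianchi (hD : IsLeviCivita D) (hX : SmoothNear X x) (hY : SmoothNear Y x)
    (hZ : SmoothNear Z x) :
    curvatureOp D X Y Z x + curvatureOp D Y Z X x + curvatureOp D Z X Y x = 0 := by
  have key : ∀ {X Y Z : Π x : M, TangentSpace I x}, SmoothNear X x → SmoothNear Y x →
      SmoothNear Z x → D X x (mlieBracket I Y Z x) -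
        (D (fun y ↦ D Z y (Y y)) x (X x) - D (fun y ↦ D Y y (Z y)) x (X x)) =
        mlieBracket I (mlieBracket I Y Z) X x := by
    intro X Y Z hX hY hZ
    have hs := hD.smooth
    rw [← connection_sub D (SmoothNear.connection hs hY hZ) (SmoothNear.connection hs hZ hY),
      ← torsion_free_apply hD (hY.mlieBracket hZ) hX]
    congr 1
    refine connection_congr D ((SmoothNear.connection hs hY hZ).sub
      (SmoothNear.connection hs hZ hY)) ?_ _
    filter_upwards [hY.eventually, hZ.eventually] with y h1 h2
    exact torsion_free_apply hD h1 h2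
  have h1 := key hX hY hZ
  have h2 := key hY hZ hX
  have h3 := key hZ hX hY
  have : IsManifold I (minSmoothness ℝ 3) M := by
    simp only [minSmoothness_of_isRCLikeNormedField]
    infer_instance
  have hle : ∀ {Z : Π x : M, TangentSpace I x}, SmoothNear Z x →
      CMDiffAt (minSmoothness ℝ 2) (T% Z) x := fun hZ ↦ by
    simp only [minSmoothness_of_isRCLikeNormedField]
    exact hZ.contMDiffAt.of_le ENat.LEInfty.out
  have hjac := leibniz_identity_mlieBracket_apply (hle hX) (hle hY) (hle hZ)
  rw [mlieBracket_swap_apply (V := X) (W := mlieBracket I Y Z),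
    mlieBracket_swap_apply (V := Y) (W := mlieBracket I X Z),
    mlieBracket_swap (V := X) (W := Z)] at hjac
  have hneg : mlieBracket I (-mlieBracket I Z X) Y x = -mlieBracket I (mlieBracket I Z X) Y x := by
    have := mlieBracket_const_smul_left (W := Y) (c := (-1 : ℝ)) (hZ.mlieBracket hX).mdiffAt
    simpa using this
  rw [hneg] at hjac
  simp only [curvatureOp]
  linear_combination (norm := module) h1 + h2 + h3 - hjac

theorem isLinearMap_curvatureOp_ext [Nontrivial E] (hD : IsSmooth D) (u v : TangentSpace I x) :
    IsLinearMap ℝ fun w : TangentSpace I x ↦ curvatureOp D (SAH.ext u) (SAH.ext v) (SAH.ext w) x :=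
  (curvatureOp_tensorial₃ hD (SmoothNear.ext u) (SmoothNear.ext v)).isLinearMap_ext

/-- Skewness in the last pair is the polarisation of `inner_curvatureOp_self`; pair symmetry is then
formal. -/
theorem isCurvature_riem [Nontrivial E] (hD : IsLeviCivita D) (x : M) :
    IsCurvature (riem D x) := by
  have hsm : ∀ v : TangentSpace I x, SmoothNear (SAH.ext v) x := SmoothNear.ext
  have h1 : ∀ a b c d : TangentSpace I x, riem D x b a c d = -riem D x a b c d := fun a b c d ↦ by
    rw [riem, curvatureOp_swap, inner_neg_left, riem]
  have hlin := isLinearMap_curvatureOp_ext (x := x) hD.smooth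
  have h0 : ∀ a b c : TangentSpace I x, riem D x a b c c = 0 := fun a b c ↦ by
    have := inner_curvatureOp_self hD.smooth hD.metric (hsm a) (hsm b) (hsm c)
    rwa [ext_self] at this
  have h2 : ∀ a b c d : TangentSpace I x, riem D x a b d c = -riem D x a b c d := by
    intro a b c d
    have h := h0 a b (c + d)
    have hc := h0 a b c
    have hd := h0 a b d
    simp only [riem] at h hc hd ⊢
    rw [(hlin a b).map_add, inner_add_left, inner_add_right, inner_add_right, hc, hd] at h
    linarith
  have h3 : ∀ a b c d : TangentSpace I x,
      riem D x a b c d + riem D x b c a d + riem D x c a b d = 0 := fun a b c d ↦ by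
    simp only [riem]
    rw [← inner_add_left, ← inner_add_left, curvatureOp_bianchi hD (hsm a) (hsm b) (hsm c),
      inner_zero_left]
  refine ⟨fun a a' b c d ↦ ?_, fun t a b c d ↦ ?_, h1, pair_symm_of_bianchi h1 h2 h3, h3⟩
  · have h := (curvatureOp_tensorial₁ (Y := SAH.ext b) hD.smooth (hsm c)).isLinearMap_ext.map_add a a'
    simp only [riem]
    rw [← inner_add_left, ← h]
  · have h := (curvatureOp_tensorial₁ (Y := SAH.ext b) hD.smooth (hsm c)).isLinearMap_ext.map_smul t a
    simp only [riem]
    rw [← real_inner_smul_left, ← h]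

end Curvature

/-! ### The decomposition `∇̄ = ∇ + ξ + η̂ ⊗ J` and the comparison of curvatures. -/

section MinimalConnection

open Filter Topology

set_option linter.unusedSectionVars false

variable {n : ℕ} {E : Type*} [NormedAddCommGroup E] [NormedSpace ℝ E] [FiniteDimensional ℝ E]
  {H : Type*} [TopologicalSpace H] {I : ModelWithCorners ℝ E H}
  {M : Type*} [TopologicalSpace M] [ChartedSpace H M] [IsManifold I ∞ M]
  [RiemannianBundle (fun x : M ↦ TangentSpace I x)]
  [IsContMDiffRiemannianBundle I ∞ E (fun x : M ↦ TangentSpace I x)]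
  {S : SpecialAlmostHermitian n I M} {D Dbar : Connection I M}
  {X Y Z W : Π x : M, TangentSpace I x} {x : M}

theorem SpecialAlmostHermitian.isOrthComplex (S : SpecialAlmostHermitian n I M) (x : M) :
    IsOrthComplex (S.J x) := ⟨S.J_J x, S.J_inner x⟩

theorem SmoothNear.J (S : SpecialAlmostHermitian n I M) (hX : SmoothNear X x) :
    SmoothNear (fun y ↦ S.J y (X y)) x := by
  filter_upwards [hX] with y h using S.J_smooth X y h

theorem diff_apply (u : TangentSpace I x) (hW : SmoothNear W x) :
    diff D Dbar x u (W x) = Dbar W x u - D W x u :=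
  congr($(IsCovariantDerivativeOn.difference_apply Dbar.isCovariantDerivativeOnUniv
    D.isCovariantDerivativeOnUniv (Set.mem_univ x) hW.mdiffAt) u)

/-- `-½ J (∇_u J) W` as an operation on vector fields `W`. -/
theorem xi_tensorial (S : SpecialAlmostHermitian n I M) (D : Connection I M)
    (u : TangentSpace I x) : IsSmoothTensorial (fun W : Π x : M, TangentSpace I x ↦
      -(1 / 2 : ℝ) • S.J x (D (fun y ↦ S.J y (W y)) x u - S.J x (D W x u))) x where
  smul {f W} hf hW := by
    simp only [map_smul]
    rw [connection_smul D hf (hW.J S), connection_smul D hf hW]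
    simp only [map_sub, map_add, map_smul]
    module
  add {W W'} hW hW' := by
    simp only [map_add]
    rw [connection_add D (hW.J S) (hW'.J S), connection_add D hW hW']
    simp only [map_sub, map_add]
    module

/-- Tensoriality frees `ξ` from the particular extension in its definition, so that it can be
evaluated on fields such as `J W` and differentiated. -/
theorem xi_apply (u : TangentSpace I x) (hW : SmoothNear W x) : xi S D x u (W x) =
    -(1 / 2 : ℝ) • S.J x (D (fun y ↦ S.J y (W y)) x u - S.J x (D W x u)) :=
  (xi_tensorial S D u).pointwise (SmoothNear.ext _) hW (ext_self _)

theorem isLinearMap_xi (u : TangentSpace I x) : IsLinearMap ℝ (xi S D x u) :=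
  (xi_tensorial S D u).isLinearMap_ext

theorem xi_add_left (u u' v : TangentSpace I x) :
    xi S D x (u + u') v = xi S D x u v + xi S D x u' v := by
  simp only [xi, map_add, map_sub]; module

theorem xi_sub_left (u u' v : TangentSpace I x) :
    xi S D x (u - u') v = xi S D x u v - xi S D x u' v := by
  simp only [xi, map_sub]; module

/-- This is the derivative of `J² = -1`: `∇J` anticommutes with `J`. -/
theorem xi_J (u v : TangentSpace I x) : xi S D x u (S.J x v) = -S.J x (xi S D x u v) := by
  have hv : SmoothNear (SAH.ext v) x := SmoothNear.ext v
  have h := xi_apply (S := S) (D := D) u (hv.J S)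
  have h' := xi_apply (S := S) (D := D) u hv
  simp only [S.J_J, ext_self] at h h'
  rw [connection_neg D hv] at h
  rw [h, h']
  simp only [map_sub, map_neg, map_smul, S.J_J]
  module

/-- Differentiate `⟨JV, JW⟩ = ⟨V, W⟩` with the metric connection. -/
theorem inner_xi (hD : IsMetric D) (u v w : TangentSpace I x) :
    (inner ℝ (xi S D x u v) w : ℝ) = -inner ℝ v (xi S D x u w) := by
  have hJ := S.isOrthComplex x
  have hv : SmoothNear (SAH.ext v) x := SmoothNear.ext v
  have hw : SmoothNear (SAH.ext w) x := SmoothNear.ext w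
  have h1 := hD _ _ x u hv.contMDiffAt hw.contMDiffAt
  have h2 := hD _ _ x u (hv.J S).contMDiffAt (hw.J S).contMDiffAt
  simp only [S.J_inner, ext_self] at h1 h2
  have h3 : ∀ a b : TangentSpace I x, (inner ℝ (S.J x a) b : ℝ) = -inner ℝ a (S.J x b) :=
    fun a b ↦ by rw [hJ.inner_right, neg_neg]
  simp only [xi, real_inner_smul_left, real_inner_smul_right, inner_sub_left, inner_sub_right,
    map_sub, S.J_J, inner_neg_left, inner_neg_right, h3]
  rw [h1] at h2
  have h4 := hJ.inner_right v (D (fun y ↦ S.J y (SAH.ext w y)) x u)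
  rw [h3] at h4
  have h5 : inner ℝ v (S.J x (D (fun y ↦ S.J y (SAH.ext w y)) x u)) =
      -inner ℝ (S.J x v) (D (fun y ↦ S.J y (SAH.ext w y)) x u) := hJ.inner_right _ _
  rw [h5]
  linarith

theorem SmoothNear.xi (hD : IsSmooth D) (hX : SmoothNear X x) (hW : SmoothNear W x) :
    SmoothNear (fun y ↦ xi S D y (X y) (W y)) x := by
  have h1 := SmoothNear.connection hD hX (hW.J S)
  have h2 := (SmoothNear.connection hD hX hW).J S
  refine (((h1.sub h2).J S).const_smul (-(1 / 2))).congr ?_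
  filter_upwards [hW.eventually] with y hy
  exact (xi_apply _ hy).symm

theorem finrank_tangentSpace (hdim : Module.finrank ℝ E = 2 * n) :
    Module.finrank ℝ (TangentSpace I x) = 2 * n := hdim

/-- As `∇̄J = 0`, the derivative `∇J` is a commutator of `J` with `∇̄ - ∇`; so `ξ` is the
`J`-antilinear part of that difference. -/
theorem xi_eq_half_diff (hDbar : IsMinimalSU S D Dbar) (u v : TangentSpace I x) :
    xi S D x u v = (1 / 2 : ℝ) • (diff D Dbar x u v + S.J x (diff D Dbar x u (S.J x v))) := by
  have hv : SmoothNear (SAH.ext v) x := SmoothNear.ext v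
  have h0 := xi_apply (S := S) (D := D) u hv
  have h1 := diff_apply (D := D) (Dbar := Dbar) u hv
  have h2 := diff_apply (D := D) (Dbar := Dbar) u (hv.J S)
  rw [hDbar.parallel_J _ x u hv.contMDiffAt] at h2
  rw [ext_self] at h0 h1
  simp only [ext_self] at h2
  rw [h0, h1, h2]
  simp only [map_sub, S.J_J]
  module

theorem diff_sub_J_diff_J (hn : n ≠ 0) (hdim : Module.finrank ℝ E = 2 * n)
    (hDbar : IsMinimalSU S D Dbar) (u v : TangentSpace I x) :
    diff D Dbar x u v - S.J x (diff D Dbar x u (S.J x v)) =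
      (2 * etaHat S D Dbar x u) • S.J x v := by
  have : FiniteDimensional ℝ (TangentSpace I x) := inferInstanceAs (FiniteDimensional ℝ E)
  exact linearPart_eq_of_perp_su (V := TangentSpace I x) hn (finrank_tangentSpace hdim)
    (S.isOrthComplex x) (hDbar.perp x u).1 (fun B h1 h2 h3 ↦ (hDbar.perp x u).2 B ⟨h1, h2, h3⟩) v

/-- The minimal connection is `∇ + ξ + η̂ ⊗ J`. -/
theorem diff_eq_xi_add_etaHat (hn : n ≠ 0) (hdim : Module.finrank ℝ E = 2 * n)
    (hDbar : IsMinimalSU S D Dbar) (u v : TangentSpace I x) :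
    diff D Dbar x u v = xi S D x u v + etaHat S D Dbar x u • S.J x v := by
  have h := diff_sub_J_diff_J hn hdim hDbar u v
  rw [xi_eq_half_diff hDbar]
  linear_combination (norm := module) (1 / 2 : ℝ) • h

theorem nablaTilde_eq (hn : n ≠ 0) (hdim : Module.finrank ℝ E = 2 * n)
    (hDbar : IsMinimalSU S D Dbar) (hY : SmoothNear Y x) (u : TangentSpace I x) :
    nablaTilde S D Y x u = Dbar Y x u - etaHat S D Dbar x u • S.J x (Y x) := by
  have h := diff_eq_xi_add_etaHat hn hdim hDbar u (Y x)
  rw [diff_apply u hY] at h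
  rw [nablaTilde]
  linear_combination (norm := module) -h

/-- Instead of the trace defining `η̂`, use `(∇̄ - ∇ - ξ)_X W = η̂(X) J W` and pair with `J W` for
`W` nonvanishing near `x`. -/
theorem smoothFunNear_etaHat (hn : n ≠ 0) (hdim : Module.finrank ℝ E = 2 * n) (hD : IsSmooth D)
    (hDbar : IsMinimalSU S D Dbar) (hX : SmoothNear X x) :
    SmoothFunNear I (fun y ↦ etaHat S D Dbar y (X y)) x := by
  have : Nontrivial E := Module.nontrivial_of_finrank_pos (R := ℝ) (by omega)
  obtain ⟨w, hw⟩ := exists_ext_ne_zero (I := I) x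
  set W : Π x : M, TangentSpace I x := SAH.ext w
  have hW : SmoothNear W x := SmoothNear.ext w
  have hne : (inner ℝ (W x) (W x) : ℝ) ≠ 0 := by
    rw [show W x = w from ext_self w]; simpa using hw
  have hF := ((SmoothNear.connection hDbar.smooth hX hW).sub
    (SmoothNear.connection hD hX hW)).sub (SmoothNear.xi (S := S) hD hX hW)
  refine ((hF.inner (hW.J S)).div (hW.inner hW) hne).congr ?_
  filter_upwards [(hW.inner hW).contMDiffAt.continuousAt.eventually_ne hne, hW.eventually]
    with y hy h
  rw [← diff_apply _ h, diff_eq_xi_add_etaHat hn hdim hDbar, add_sub_cancel_left,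
    real_inner_smul_left, S.J_inner, mul_div_assoc, div_self hy, mul_one]

/-- `∇̃` differs from `∇̄` by a multiple of `J`, which commutes with `J`. -/
theorem nablaTilde_J (hn : n ≠ 0) (hdim : Module.finrank ℝ E = 2 * n)
    (hDbar : IsMinimalSU S D Dbar) (hY : SmoothNear Y x) (u : TangentSpace I x) :
    nablaTilde S D (fun y ↦ S.J y (Y y)) x u = S.J x (nablaTilde S D Y x u) := by
  rw [nablaTilde_eq hn hdim hDbar (hY.J S), nablaTilde_eq hn hdim hDbar hY,
    hDbar.parallel_J _ x u hY.contMDiffAt, map_sub, map_smul]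

theorem nablaTilde_add (hX : SmoothNear X x) (hY : SmoothNear Y x) (u : TangentSpace I x) :
    nablaTilde S D (fun y ↦ X y + Y y) x u = nablaTilde S D X x u + nablaTilde S D Y x u := by
  simp only [nablaTilde]
  rw [connection_add D hX hY, (isLinearMap_xi u).map_add]
  abel

theorem nablaTilde_smul {f : M → ℝ} (hf : SmoothFunNear I f x) (hY : SmoothNear Y x)
    (u : TangentSpace I x) : nablaTilde S D (fun y ↦ f y • Y y) x u =
      f x • nablaTilde S D Y x u + d% f x u • Y x := by
  simp only [nablaTilde]
  rw [connection_smul D hf hY, (isLinearMap_xi u).map_smul]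
  module

theorem nablaTilde_congr (hX : SmoothNear X x) (h : ∀ᶠ y in 𝓝 x, X y = Y y)
    (u : TangentSpace I x) : nablaTilde S D X x u = nablaTilde S D Y x u := by
  simp only [nablaTilde]
  rw [connection_congr D hX h, h.self_of_nhds]

theorem nablaTilde_neg (hX : SmoothNear X x) (u : TangentSpace I x) :
    nablaTilde S D (fun y ↦ -X y) x u = -nablaTilde S D X x u := by
  simp only [nablaTilde]
  rw [connection_neg D hX, (isLinearMap_xi u).map_neg]
  abel

/-- `(∇̃_u ξ)_v W` as an operation on vector fields `W`. -/
theorem nablaXi_tensorial (hD : IsSmooth D) (u v : TangentSpace I x) :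
    IsSmoothTensorial (fun W : Π x : M, TangentSpace I x ↦
      nablaTilde S D (fun y ↦ xi S D y (SAH.ext v y) (W y)) x u
        - xi S D x (nablaTilde S D (SAH.ext v) x u) (W x)
        - xi S D x v (nablaTilde S D W x u)) x where
  smul {f W} hf hW := by
    have hxi : SmoothNear (fun y ↦ xi S D y (SAH.ext v y) (W y)) x :=
      SmoothNear.xi hD (SmoothNear.ext v) hW
    simp only [(isLinearMap_xi _).map_smul]
    rw [nablaTilde_smul hf hxi, nablaTilde_smul hf hW, (isLinearMap_xi _).map_add,
      (isLinearMap_xi _).map_smul, (isLinearMap_xi _).map_smul, ext_self]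
    module
  add {W W'} hW hW' := by
    have hxi : SmoothNear (fun y ↦ xi S D y (SAH.ext v y) (W y)) x :=
      SmoothNear.xi hD (SmoothNear.ext v) hW
    have hxi' : SmoothNear (fun y ↦ xi S D y (SAH.ext v y) (W' y)) x :=
      SmoothNear.xi hD (SmoothNear.ext v) hW'
    simp only [(isLinearMap_xi _).map_add]
    rw [nablaTilde_add hxi hxi', nablaTilde_add hW hW', (isLinearMap_xi _).map_add]
    abel

theorem nablaXi_apply (hD : IsSmooth D) (u v : TangentSpace I x) (hW : SmoothNear W x) :
    nablaXi S D x u v (W x) = nablaTilde S D (fun y ↦ xi S D y (SAH.ext v y) (W y)) x u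
        - xi S D x (nablaTilde S D (SAH.ext v) x u) (W x)
        - xi S D x v (nablaTilde S D W x u) := by
  have h := (nablaXi_tensorial (S := S) hD u v).pointwise (SmoothNear.ext (W x)) hW (ext_self _)
  simp only [ext_self] at h
  exact h

theorem isLinearMap_nablaXi (hD : IsSmooth D) (u v : TangentSpace I x) :
    IsLinearMap ℝ (nablaXi S D x u v) := by
  have h := (nablaXi_tensorial (S := S) hD u v).isLinearMap_ext
  simp only [ext_self] at h
  exact h

/-- Differentiate `ξ J = -J ξ` with `∇̃`, for which `J` is parallel. -/
theorem nablaXi_J (hn : n ≠ 0) (hdim : Module.finrank ℝ E = 2 * n) (hD : IsSmooth D)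
    (hDbar : IsMinimalSU S D Dbar) (u v w : TangentSpace I x) :
    nablaXi S D x u v (S.J x w) = -S.J x (nablaXi S D x u v w) := by
  have hw : SmoothNear (SAH.ext w) x := SmoothNear.ext w
  have h := nablaXi_apply (S := S) hD u v (hw.J S)
  have hxi : SmoothNear (fun y ↦ xi S D y (SAH.ext v y) (SAH.ext w y)) x :=
      SmoothNear.xi hD (SmoothNear.ext v) hw
  simp only [xi_J, ext_self] at h
  rw [nablaTilde_neg (hxi.J S), nablaTilde_J hn hdim hDbar hxi, nablaTilde_J hn hdim hDbar hw,
    xi_J] at h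
  rw [h, nablaXi]
  simp only [map_sub]
  abel

/-- The curvature of `∇` in terms of the curvature of the minimal connection and the torsion. -/
theorem curvatureOp_eq (hn : n ≠ 0) (hdim : Module.finrank ℝ E = 2 * n) (hD : IsLeviCivita D)
    (hDbar : IsMinimalSU S D Dbar) (u v w : TangentSpace I x) :
    curvatureOp D (SAH.ext u) (SAH.ext v) (SAH.ext w) x =
      curvatureOp Dbar (SAH.ext u) (SAH.ext v) (SAH.ext w) x
      + dOne (etaHat S D Dbar) x u v • S.J x w
      + (nablaXi S D x u v w - nablaXi S D x v u w + xi S D x (xi S D x u v) w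
        - xi S D x (xi S D x v u) w)
      - (xi S D x u (xi S D x v w) - xi S D x v (xi S D x u w)) := by
  have hsm : ∀ v : TangentSpace I x, SmoothNear (SAH.ext v) x := SmoothNear.ext
  have hw := hsm w
  -- Second derivatives are expanded through `∇ = ∇̃ - ξ` and `∇̃ = ∇̄ - η̂ ⊗ J`. The terms with
  -- `η̂` times `J∇̄w`, with `η̂ η̂`, and with `ξ` applied to `∇̃w` are symmetric in `u, v` and
  -- cancel on alternation.
  have key : ∀ u v : TangentSpace I x, D (fun y ↦ D (SAH.ext w) y (SAH.ext v y)) x u =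
      Dbar (fun y ↦ Dbar (SAH.ext w) y (SAH.ext v y)) x u
      - etaHat S D Dbar x v • S.J x (Dbar (SAH.ext w) x u)
      - d% (fun y ↦ etaHat S D Dbar y (SAH.ext v y)) x u • S.J x w
      - etaHat S D Dbar x u • S.J x (Dbar (SAH.ext w) x v)
      - (etaHat S D Dbar x u * etaHat S D Dbar x v) • w
      - xi S D x u (nablaTilde S D (SAH.ext w) x v)
      - (nablaXi S D x u v w + xi S D x (nablaTilde S D (SAH.ext v) x u) w
        + xi S D x v (nablaTilde S D (SAH.ext w) x u)) + xi S D x u (xi S D x v w) := by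
    intro u v
    have hv := hsm v
    have hDw := SmoothNear.connection hD.smooth hv hw
    have hDbw := SmoothNear.connection hDbar.smooth hv hw
    have hxi : SmoothNear (fun y ↦ xi S D y (SAH.ext v y) (SAH.ext w y)) x :=
      SmoothNear.xi hD.smooth hv hw
    have heta := smoothFunNear_etaHat hn hdim hD.smooth hDbar hv
    have hEJ := SmoothNear.smul heta (hw.J S)
    have hT : SmoothNear (fun y ↦ nablaTilde S D (SAH.ext w) y (SAH.ext v y)) x := hDw.add hxi
    have hTeq : ∀ᶠ y in 𝓝 x, nablaTilde S D (SAH.ext w) y (SAH.ext v y) =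
        Dbar (SAH.ext w) y (SAH.ext v y) -
          etaHat S D Dbar y (SAH.ext v y) • S.J y (SAH.ext w y) := by
      filter_upwards [hw.eventually] with y hy
      exact nablaTilde_eq hn hdim hDbar hy _
    have h1 : D (fun y ↦ D (SAH.ext w) y (SAH.ext v y)) x u =
        D (fun y ↦ nablaTilde S D (SAH.ext w) y (SAH.ext v y)) x u -
          D (fun y ↦ xi S D y (SAH.ext v y) (SAH.ext w y)) x u := by
      rw [← connection_sub D hT hxi]
      refine connection_congr D hDw (Eventually.of_forall fun y ↦ ?_) u
      simp only [nablaTilde, add_sub_cancel_right]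
    have h2 : ∀ {Y : Π x : M, TangentSpace I x}, D Y x u =
        nablaTilde S D Y x u - xi S D x u (Y x) := by
      intro Y; simp only [nablaTilde, add_sub_cancel_right]
    have h3 : nablaTilde S D (fun y ↦ nablaTilde S D (SAH.ext w) y (SAH.ext v y)) x u =
        Dbar (fun y ↦ Dbar (SAH.ext w) y (SAH.ext v y)) x u
        - (etaHat S D Dbar x v • S.J x (Dbar (SAH.ext w) x u)
        + d% (fun y ↦ etaHat S D Dbar y (SAH.ext v y)) x u • S.J x w)
        - etaHat S D Dbar x u • S.J x (Dbar (SAH.ext w) x v - etaHat S D Dbar x v • S.J x w) := by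
      rw [nablaTilde_congr hT hTeq, nablaTilde_eq hn hdim hDbar (hDbw.sub hEJ),
        connection_sub Dbar hDbw hEJ, connection_smul Dbar heta (hw.J S),
        hDbar.parallel_J _ x u hw.contMDiffAt]
      simp only [ext_self]
    have h4 : nablaTilde S D (fun y ↦ xi S D y (SAH.ext v y) (SAH.ext w y)) x u =
        nablaXi S D x u v w + xi S D x (nablaTilde S D (SAH.ext v) x u) w
        + xi S D x v (nablaTilde S D (SAH.ext w) x u) := by
      rw [nablaXi]; abel
    rw [h1, h2, h2, h3, h4]
    simp only [ext_self, map_sub, map_smul, S.J_J]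
    module
  set U : Π x : M, TangentSpace I x := SAH.ext u with hU
  set V : Π x : M, TangentSpace I x := SAH.ext v with hV
  have hUx : U x = u := ext_self u
  have hVx : V x = v := ext_self v
  have hwx : SAH.ext w x = w := ext_self w
  have hbr : D (SAH.ext w) x (mlieBracket I U V x) = Dbar (SAH.ext w) x (mlieBracket I U V x)
      - xi S D x (mlieBracket I U V x) w
      - etaHat S D Dbar x (mlieBracket I U V x) • S.J x w := by
    have h := nablaTilde_eq hn hdim hDbar hw (mlieBracket I U V x)
    rw [nablaTilde, hwx] at h
    linear_combination (norm := module) h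
  -- The torsion of `∇̃` is `ξ_u v - ξ_v u`; it is the source of the terms `ξ_{ξ_u v} - ξ_{ξ_v u}`.
  have htor : nablaTilde S D V x u - nablaTilde S D U x v =
      mlieBracket I U V x + xi S D x u v - xi S D x v u := by
    have h := torsion_free_apply hD (hsm u) (hsm v)
    rw [← hU, ← hV, hUx, hVx] at h
    simp only [nablaTilde, hUx, hVx]
    linear_combination (norm := module) h
  have hxitor : xi S D x (nablaTilde S D V x u) w - xi S D x (nablaTilde S D U x v) w =
      xi S D x (mlieBracket I U V x) w + xi S D x (xi S D x u v) w
        - xi S D x (xi S D x v u) w := by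
    rw [← xi_sub_left, htor, xi_sub_left, xi_add_left]
  have k1 := key u v
  have k2 := key v u
  rw [← hV] at k1
  rw [← hU] at k2
  have hd : dOne (etaHat S D Dbar) x u v = d% (fun y ↦ etaHat S D Dbar y (V y)) x u
    - d% (fun y ↦ etaHat S D Dbar y (U y)) x v - etaHat S D Dbar x (mlieBracket I U V x) := rfl
  simp only [curvatureOp, hUx, hVx]
  rw [k1, k2, hbr, hd]
  linear_combination (norm := module) hxitor

end MinimalConnection

/-! ### The curvature of the minimal connection is `su(n)`-valued. -/

section VolumeForm

open Filter Topology

set_option linter.unusedSectionVars false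

variable {n : ℕ} {E : Type*} [NormedAddCommGroup E] [NormedSpace ℝ E] [FiniteDimensional ℝ E]
  {H : Type*} [TopologicalSpace H] {I : ModelWithCorners ℝ E H}
  {M : Type*} [TopologicalSpace M] [ChartedSpace H M] [IsManifold I ∞ M]

theorem mvfderiv_clm_comp {F G : Type*} [NormedAddCommGroup F] [NormedSpace ℝ F]
    [NormedAddCommGroup G] [NormedSpace ℝ G] (L : F →L[ℝ] G) {f : M → F} {x : M}
    (hf : MDiffAt f x) (u : TangentSpace I x) :
    d% (fun y ↦ L (f y)) x u = L (d% f x u) := by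
  have hL : MDiffAt (L : F → G) (f x) := L.differentiableAt.mdifferentiableAt
  have h := mfderiv_comp (I := I) (I' := 𝓘(ℝ, F)) (I'' := 𝓘(ℝ, G)) x hL hf
  rw [L.mfderiv_eq] at h
  exact congr($h u)

theorem mvfderiv_finset_sum {ι : Type*} {s : Finset ι} {f : ι → M → ℝ} {x : M}
    (hf : ∀ i ∈ s, MDiffAt (f i) x) (u : TangentSpace I x) :
    MDiffAt (fun y ↦ ∑ i ∈ s, f i y) x ∧
      d% (fun y ↦ ∑ i ∈ s, f i y) x u = ∑ i ∈ s, d% (f i) x u := by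
  classical
  induction s using Finset.induction_on with
  | empty =>
    refine ⟨by simpa using mdifferentiableAt_const, ?_⟩
    simp only [Finset.sum_empty]
    exact congr($(mvfderiv_const (I := I) (0 : ℝ)) u)
  | insert a s ha ih =>
    simp only [Finset.mem_insert, forall_eq_or_imp] at hf
    obtain ⟨h1, h2⟩ := ih hf.2
    simp only [Finset.sum_insert ha]
    refine ⟨hf.1.add h1, ?_⟩
    rw [← h2]
    exact congr($(mvfderiv_add hf.1 h1) u)

variable
  [RiemannianBundle (fun x : M ↦ TangentSpace I x)]
  [IsContMDiffRiemannianBundle I ∞ E (fun x : M ↦ TangentSpace I x)]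
  {S : SpecialAlmostHermitian n I M} {D Dbar : Connection I M} {x : M}

section Frames

variable {Y : Fin n → Π x : M, TangentSpace I x} {U V : Π x : M, TangentSpace I x}

/-- The commutator formula concerns real functions, so `Ψ` is composed with real functionals `L`,
eventually its real and imaginary parts. -/
theorem smoothFunNear_clm_Ψ (L : ℂ →L[ℝ] ℝ) (hY : ∀ i, SmoothNear (Y i) x) :
    SmoothFunNear I (fun y ↦ L (S.Ψ y fun i ↦ Y i y)) x := by
  filter_upwards [eventually_all.mpr hY] with y h
  exact L.contMDiff.contMDiffAt.comp y (S.Ψ_smooth Y y h)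

theorem deriv_clm_Ψ (L : ℂ →L[ℝ] ℝ) (hDbar : IsMinimalSU S D Dbar)
    (hY : ∀ i, CMDiffAt ∞ (T% (Y i)) x) (u : TangentSpace I x) :
    d% (fun y ↦ L (S.Ψ y fun i ↦ Y i y)) x u =
      ∑ i, L (S.Ψ x (Function.update (fun j ↦ Y j x) i (Dbar (Y i) x u))) := by
  rw [mvfderiv_clm_comp L ((S.Ψ_smooth Y x hY).mdifferentiableAt (by simp)),
    hDbar.parallel_Ψ Y x u hY, map_sum]

theorem update_field_apply (i : Fin n) (Z : Π x : M, TangentSpace I x) (y : M) :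
    (fun j ↦ (Function.update Y i Z : Fin n → Π x : M, TangentSpace I x) j y) =
      Function.update (fun j ↦ Y j y) i (Z y) := by
  funext j
  rcases eq_or_ne j i with rfl | h
  · simp
  · simp [h]

/-- The first sum has both derivatives on one argument and yields the curvature; the second has them
on different arguments and is symmetric in the two directions. -/
theorem deriv_deriv_clm_Ψ (L : ℂ →L[ℝ] ℝ) (hDbar : IsMinimalSU S D Dbar)
    (hY : ∀ i, SmoothNear (Y i) x) (hV : SmoothNear V x) (u : TangentSpace I x) :
    d% (fun y ↦ d% (fun z ↦ L (S.Ψ z fun i ↦ Y i z)) y (V y)) x u =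
      ∑ i, L (S.Ψ x (Function.update (fun j ↦ Y j x) i (Dbar (fun y ↦ Dbar (Y i) y (V y)) x u)))
      + ∑ i, ∑ j ∈ Finset.univ.erase i, L (S.Ψ x (Function.update
        (Function.update (fun j ↦ Y j x) i (Dbar (Y i) x (V x))) j (Dbar (Y j) x u))) := by
  have hDY := fun i ↦ SmoothNear.connection hDbar.smooth hV (hY i)
  have hupd : ∀ i j, SmoothNear ((Function.update Y i fun y ↦ Dbar (Y i) y (V y) :
      Fin n → Π x : M, TangentSpace I x) j) x := fun i j ↦ by
    rcases eq_or_ne j i with rfl | h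
    · simpa using hDY j
    · simpa [h] using hY j
  have heq : (fun y ↦ d% (fun z ↦ L (S.Ψ z fun i ↦ Y i z)) y (V y)) =ᶠ[𝓝 x] fun y ↦
      ∑ i, L (S.Ψ y fun j ↦ (Function.update Y i fun y ↦ Dbar (Y i) y (V y) :
        Fin n → Π x : M, TangentSpace I x) j y) := by
    filter_upwards [eventually_all.mpr hY] with y h
    rw [deriv_clm_Ψ L hDbar h]
    simp only [update_field_apply]
  rw [mvfderiv_congr heq,
    (mvfderiv_finset_sum (fun i _ ↦ (smoothFunNear_clm_Ψ L (hupd i)).mdiffAt) u).2,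
    ← Finset.sum_add_distrib]
  refine Finset.sum_congr rfl fun i _ ↦ ?_
  rw [deriv_clm_Ψ L hDbar (fun j ↦ (hupd i j).contMDiffAt),
    ← Finset.add_sum_erase _ _ (Finset.mem_univ i)]
  simp only [update_field_apply, Function.update_idem, Function.update_self]
  congr 1
  refine Finset.sum_congr rfl fun j hj ↦ ?_
  rw [Function.update_of_ne (Finset.ne_of_mem_erase hj)]

/-- The curvature of a connection for which `Ψ` is parallel annihilates `Ψ`. -/
theorem sum_Ψ_update_curvatureOp [Nontrivial E] (hDbar : IsMinimalSU S D Dbar)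
    (hY : ∀ i, SmoothNear (Y i) x) (hU : SmoothNear U x) (hV : SmoothNear V x) :
    ∑ i, S.Ψ x (Function.update (fun j ↦ Y j x) i (curvatureOp Dbar U V (Y i) x)) = 0 := by
  have key : ∀ L : ℂ →L[ℝ] ℝ, L (∑ i, S.Ψ x (Function.update (fun j ↦ Y j x) i
      (curvatureOp Dbar U V (Y i) x))) = 0 := by
    intro L
    have h := deriv_deriv_sub (smoothFunNear_clm_Ψ (S := S) L hY) hU hV
    rw [deriv_deriv_clm_Ψ L hDbar hY hV, deriv_deriv_clm_Ψ L hDbar hY hU,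
      deriv_clm_Ψ L hDbar fun i ↦ (hY i).contMDiffAt] at h
    -- Exchanging the names of the two differentiated slots shows that the mixed terms cancel in the
    -- commutator.
    have hswap : ∑ i, ∑ j ∈ Finset.univ.erase i, L (S.Ψ x (Function.update
        (Function.update (fun j ↦ Y j x) i (Dbar (Y i) x (V x))) j (Dbar (Y j) x (U x)))) =
        ∑ i, ∑ j ∈ Finset.univ.erase i, L (S.Ψ x (Function.update
        (Function.update (fun j ↦ Y j x) i (Dbar (Y i) x (U x))) j (Dbar (Y j) x (V x)))) := by
      rw [Finset.sum_comm' (t' := Finset.univ) (s' := fun i ↦ Finset.univ.erase i)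
        (fun i j ↦ by simp [eq_comm])]
      refine Finset.sum_congr rfl fun i _ ↦ Finset.sum_congr rfl fun j hj ↦ ?_
      rw [Function.update_comm (Finset.ne_of_mem_erase hj)]
    rw [hswap] at h
    simp only [curvatureOp, AlternatingMap.map_update_add, AlternatingMap.map_update_sub, map_sum,
      map_add, map_sub, Finset.sum_add_distrib, Finset.sum_sub_distrib]
    linarith
  exact Complex.ext (key Complex.reCLM) (key Complex.imCLM)

end Frames

/-- By tensoriality the extension of `J w` may be replaced by `J` of the extension of `w`; then `J`
is pulled through every `∇̄`. -/
theorem curvatureOp_J [Nontrivial E] (hDbar : IsMinimalSU S D Dbar) (u v w : TangentSpace I x) :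
    curvatureOp Dbar (SAH.ext u) (SAH.ext v) (SAH.ext (S.J x w)) x =
      S.J x (curvatureOp Dbar (SAH.ext u) (SAH.ext v) (SAH.ext w) x) := by
  have hw : SmoothNear (SAH.ext w) x := SmoothNear.ext w
  have h2 : ∀ {V : Π x : M, TangentSpace I x}, SmoothNear V x → ∀ u,
      Dbar (fun y ↦ Dbar (fun z ↦ S.J z (SAH.ext w z)) y (V y)) x u =
        S.J x (Dbar (fun y ↦ Dbar (SAH.ext w) y (V y)) x u) := by
    intro V hV u
    have hD := SmoothNear.connection hDbar.smooth hV hw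
    rw [← hDbar.parallel_J _ x u hD.contMDiffAt]
    refine connection_congr Dbar (SmoothNear.connection hDbar.smooth hV (hw.J S)) ?_ u
    filter_upwards [hw] with y hy
    exact hDbar.parallel_J _ y _ hy
  have h := (curvatureOp_tensorial₃ hDbar.smooth (SmoothNear.ext u) (SmoothNear.ext v)).pointwise
    (SmoothNear.ext (S.J x w)) (hw.J S) (by simp only [ext_self])
  refine h.trans ?_
  simp only [curvatureOp, map_add, map_sub]
  rw [h2 (SmoothNear.ext u), h2 (SmoothNear.ext v), hDbar.parallel_J _ x _ hw.contMDiffAt]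

/-- The curvature of the minimal `SU(n)`-connection takes values in `su(n)`. -/
theorem sum_inner_curvatureOp_J [Nontrivial E] (hdim : Module.finrank ℝ E = 2 * n)
    (hDbar : IsMinimalSU S D Dbar) (u v : TangentSpace I x) {ι : Type*} [Fintype ι]
    (e : OrthonormalBasis ι ℝ (TangentSpace I x)) :
    ∑ i, inner ℝ (curvatureOp Dbar (SAH.ext u) (SAH.ext v) (SAH.ext (e i)) x)
      (S.J x (e i)) = (0 : ℝ) := by
  have : FiniteDimensional ℝ (TangentSpace I x) := inferInstanceAs (FiniteDimensional ℝ E)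
  have hsm : ∀ w : TangentSpace I x, SmoothNear (SAH.ext w) x := SmoothNear.ext
  refine sum_inner_J_eq_zero (V := TangentSpace I x) (Ψ := S.Ψ x)
    (B := fun w ↦ curvatureOp Dbar (SAH.ext u) (SAH.ext v) (SAH.ext w) x)
    (S.isOrthComplex x) (finrank_tangentSpace hdim)
    (S.Ψ_J x) (fun f hf h0 ↦ ?_) (isLinearMap_curvatureOp_ext hDbar.smooth u v) (fun w ↦ ?_)
    (curvatureOp_J hDbar u v) (fun w ↦ ?_) e
  · have h := S.Ψ_unit x f hf.1 hf.2
    rw [h0, norm_zero] at h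
    exact zero_ne_one h
  · have h := inner_curvatureOp_self hDbar.smooth hDbar.metric (hsm u) (hsm v) (hsm w)
    rwa [ext_self] at h
  · have h := sum_Ψ_update_curvatureOp hDbar (fun i ↦ hsm (w i)) (hsm u) (hsm v)
    simpa only [ext_self] using h

end VolumeForm

end SAH

end

theorem lemma3p6 {n : ℕ} (hn : 2 ≤ n) {M : Type*} [TopologicalSpace M] [T2Space M]
    [ChartedSpace (EuclideanSpace ℝ (Fin (2 * n))) M]
    [IsManifold (𝓡 (2 * n)) ∞ M]
    [RiemannianBundle (fun x : M ↦ TangentSpace (𝓡 (2 * n)) x)]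
    [IsContMDiffRiemannianBundle (𝓡 (2 * n)) ∞ (EuclideanSpace ℝ (Fin (2 * n)))
      (fun x : M ↦ TangentSpace (𝓡 (2 * n)) x)]
    (S : SAH.SpecialAlmostHermitian n (𝓡 (2 * n)) M) (D Dbar : SAH.Connection (𝓡 (2 * n)) M)
    (hD : SAH.IsLeviCivita D) (hDbar : SAH.IsMinimalSU S D Dbar)
    (x : M) (e : OrthonormalBasis (Fin (2 * n)) ℝ (TangentSpace (𝓡 (2 * n)) x)) :
    -- the minimal connection is `∇̄ = ∇ + ξ + η` with `η_u v = η̂(u) J v`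
    (∀ u v : TangentSpace (𝓡 (2 * n)) x, SAH.diff D Dbar x u v =
      SAH.xi S D x u v + SAH.etaHat S D Dbar x u • S.J x v) ∧
    -- `3 Ric*_H + Ric_H` in terms of the intrinsic torsion
    (∀ X Y : TangentSpace (𝓡 (2 * n)) x,
      3 * SAH.hermPart (S.J x) (SAH.ricStar S D x e) X Y
        + SAH.hermPart (S.J x) (SAH.ric D x e) X Y =
      SAH.torsionForm S D Dbar x e X Y) ∧
    -- the component of the curvature in `𝒦₁`
    SAH.IsComponent e (SAH.IsK1 (S.J x) e) (SAH.riem D x)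
      (fun a b c d ↦ SAH.tr e (SAH.torsionForm S D Dbar x e) / (32 * n * (n + 1)) *
        SAH.kahlerOf (S.J x) (fun u v ↦ inner ℝ u v) a b c d) ∧
    -- the component of the curvature in `𝒦₂`
    SAH.IsComponent e (SAH.IsK2 (S.J x) e) (SAH.riem D x)
      (fun a b c d ↦ 1 / (8 * (n + 2)) *
        SAH.kahlerOf (S.J x) (fun u v ↦ SAH.torsionForm S D Dbar x e u v
          - SAH.tr e (SAH.torsionForm S D Dbar x e) / (2 * n) * inner ℝ u v) a b c d) := by
  have hn0 : n ≠ 0 := by omega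
  have hdim : Module.finrank ℝ (EuclideanSpace ℝ (Fin (2 * n))) = 2 * n :=
    finrank_euclideanSpace_fin
  have : Nontrivial (EuclideanSpace ℝ (Fin (2 * n))) :=
    Module.nontrivial_of_finrank_pos (R := ℝ) (by omega)
  have hJ := S.isOrthComplex x
  have hR := SAH.isCurvature_riem hD x
  have hT : ∀ X Y : TangentSpace (𝓡 (2 * n)) x,
      3 * SAH.hermPart (S.J x) (SAH.ricStar S D x e) X Y
        + SAH.hermPart (S.J x) (SAH.ric D x e) X Y = SAH.torsionForm S D Dbar x e X Y :=
    SAH.three_ricciStar_add_ricci hJ e hR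
      -- `P` is the `su(n)`-valued part of the curvature, and `N` is the `J`-antilinear derivative
      -- of the torsion.
      (P := fun u v w ↦ SAH.curvatureOp Dbar (SAH.ext u) (SAH.ext v) (SAH.ext w) x)
      (N := SAH.nablaXi S D x) (ξ := SAH.xi S D x) (dη := SAH.dOne (SAH.etaHat S D Dbar) x)
      (SAH.curvatureOp_J hDbar) (fun u v ↦ SAH.sum_inner_curvatureOp_J hdim hDbar u v e)
      (SAH.isLinearMap_nablaXi hD.smooth) (SAH.nablaXi_J hn0 hdim hD.smooth hDbar)
      SAH.isLinearMap_xi SAH.xi_J (SAH.inner_xi hD.metric)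
      (fun u v w z ↦ by rw [SAH.riem, SAH.curvatureOp_eq hn0 hdim hD hDbar])
  exact ⟨SAH.diff_eq_xi_add_etaHat hn0 hdim hDbar, hT,
    SAH.isComponent_K1 e hn0 hJ hR hT, SAH.isComponent_K2 e hn0 hJ hR hT⟩
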